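/- **Setting.** Let $\Gamma$ be a quantum graph with finite edge set $\mathcal E$: each (directed) edge $e$ has a length $l_e>0$ and a potential $V_e\in L^2([0,l_e];\mathbb C)$ (for example a bounded one), and there are given matrices $A,B\in M_{2|\mathcal E|}(\mathbb C)$, indexed by the edge ends. Put $L^2(\Gamma)=\bigoplus_e L^2([0,l_e])$ and $H^2(\Gamma)=\bigoplus_e H^2([0,l_e])$. For $f\in H^2(\Gamma)$ let $\gamma_D(f)=(f_e(0),f_e(l_e))_e$ and $\gamma_N(f)=(f_e'(0),-f_e'(l_e))_e$. The Schrödinger operator is $$\mathrm{Op}:\mathrm{Dom}(\mathrm{Op})=\{f\in H^2(\Gamma): A\gamma_D(f)+B\gamma_N(f)=0\}\to L^2(\Gamma),\qquad (\mathrm{Op}f)_e=-f_e''+V_ef_e ,$$ and $\mathrm{Dom}(\mathrm{Op})$ carries the inner product of $L^2(\Gamma)$. Let a group $G$ act on $\mathcal E$, let $\pi(g)$ be the corresponding permutation matrices ($\pi(g)\mathbf e_j=\mathbf e_{gj}$) and $\hat\pi(g)=\pi(g)\otimes I_2$. Assume that $\Gamma$ is $\pi$-symmetric, i.e. for all $g\in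 G$, $e\in\mathcal E$ one has $l_{ge}=l_e$ and $V_{ge}=V_e$ (almost everywhere), and $AF+BF'=0\Leftrightarrow A\hat\pi(g)F+B\hat\pi(g)F'=0$ for all $F,F'\in\mathbb C^{2|\mathcal E|}$; assume also that the matrices $A,B$ chosen to express the vertex conditions satisfy $\hat\pi(g)^*A\hat\pi(g)=A$ and $\hat\pi(g)^*B\hat\pi(g)=B$ for all $g$. The group acts on functions by $(\pi(g)f)_e=f_{g^{-1}e}$. Let $\rho:G\to GL_r(\mathbb C)$ be a representation, $\mathrm V_\rho=\mathbb C^r$, and let $$\mathcal K_G(\rho,\pi)=\bigcap_{g\in G}\ker\bigl[I_r\otimes\pi(g)-\rho(g)^T\otimes I_{|\mathcal E|}\bigr]\subset\mathbb C^r\otimes\mathbb C^{|\mathcal E|}.$$ Choose a set $\mathcal D\subset\mathcal E$ containing exactly one edge $i$ of each orbit $O_i=Gi$. For $i\in\mathcal D$ let $d_i$ be the dimension of the subspace of those vectors of $\mathcal K_G(\rho,\pi)$ that are supported on $O_i$ (i.e. lie in $\mathbb C^r\otimes\mathrm{span}\{\mathbf e_j:j\in O_i\}$), let the columns of $\Theta_i$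 be any orthonormal basis of that subspace, let $\Theta$ be the matrix with blocks $\Theta_i$, $i\in\mathcal D$, side by side, and let $\hat\Theta=\Theta\otimes I_2$. The quotient graph $\Gamma_\rho$ has edges $e_{i,j}$ ($i\in\mathcal D$, $1\le j\le d_i$) with length $l_i$ and potential $V_i$, and vertex conditions given by $$A_\rho=\hat\Theta^*(I_r\otimes A)\hat\Theta,\qquad B_\rho=\hat\Theta^*(I_r\otimes B)\hat\Theta ;$$ its Schrödinger operator is $\mathrm{Op}_\rho$. For $W=L^2(\Gamma)$ or $W=\mathrm{Dom}(\mathrm{Op})$ let $\mathrm{Hom}_G(\mathrm V_\rho,W)$ be the space of linear maps $\phi:\mathrm V_\rho\to W$ with $\pi(g)\phi=\phi\rho(g)$ for all $g\in G$; identify $\phi$ with the row of its columns $\phi^{(k)}=\phi(\mathbf e_k)$ and let $\langle\phi,\psi\rangle=\sum_{k=1}^r\langle\phi^{(k)},\psi^{(k)}\rangle_{L^2(\Gamma)}$. The matrix $\Theta$ acts on $f\in L^2(\Gamma_\rho)$ by matrix multiplication, functions on edges of equal length being identified, and $\mathrm{vec}^{-1}$ turns the result, a family indexed by pairs $(k,e)$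 with $1\le k\le r$ and $e\in\mathcal E$, into the row $(\phi^{(1)},\dots,\phi^{(r)})$. **Theorem.** The map $\mathrm{vec}^{-1}\circ\Theta$ is a linear isomorphism preserving the inner product from $L^2(\Gamma_\rho)$ onto $\mathrm{Hom}_G(\mathrm V_\rho,L^2(\Gamma))$, and it restricts to a linear isomorphism preserving the inner product from $\mathrm{Dom}(\mathrm{Op}_\rho)$ onto $\mathrm{Hom}_G(\mathrm V_\rho,\mathrm{Dom}(\mathrm{Op}))$. With these isomorphisms as horizontal arrows the diagram $$\begin{array}{ccc}\mathrm{Dom}(\mathrm{Op}_\rho)&\cong&\mathrm{Hom}_G(\mathrm V_\rho,\mathrm{Dom}(\mathrm{Op}))\\ \downarrow{\scriptstyle \mathrm{Op}_\rho}&&\downarrow{\scriptstyle \mathrm{Op}}\\ L^2(\Gamma_\rho)&\cong&\mathrm{Hom}_G(\mathrm V_\rho,L^2(\Gamma))\end{array}$$ commutes, where the right arrow is $\phi\mapsto\mathrm{Op}\circ\phi$: for all $f\in\mathrm{Dom}(\mathrm{Op}_\rho)$, $\mathrm{vec}^{-1}(\Theta\,\mathrm{Op}_\rho f)=\mathrm{Op}\circ\mathrm{vec}^{-1}(\Theta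 f)$. In particular $\Gamma_\rho$ is a quotient of $\Gamma$ by $\rho$ in the sense of Parzanchevski and Band, i.e. there are linear isomorphisms that make such a diagram commute. -/

import Mathlib

open MeasureTheory Set
open scoped ContDiff InnerProductSpace Kronecker ENNReal

noncomputable section

namespace QGraph

/-- The Hilbert space `L²([0, l]; ℂ)`. -/
abbrev EdgeL2 (l : ℝ) : Type := Lp ℂ 2 (volume.restrict (Icc (0 : ℝ) l))

/-- `g` is the weak derivative of `f` on `(0, l)`, tested against smooth functions with compact
support in the open interval. -/
def IsWeakDeriv (l : ℝ) (f g : EdgeL2 l) : Prop :=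
  ∀ φ : ℝ → ℝ, ContDiff ℝ ∞ φ → HasCompactSupport φ → tsupport φ ⊆ Ioo 0 l →
    ∫ x in Icc 0 l, deriv φ x • f x = - ∫ x in Icc 0 l, φ x • g x

theorem edge_integrable {l : ℝ} (f : EdgeL2 l) :
    Integrable f (volume.restrict (Icc (0 : ℝ) l)) :=
  (Lp.memLp f).integrable (by norm_num)

theorem edge_integrable_smul {l : ℝ} (f : EdgeL2 l) {φ : ℝ → ℝ} (hφ : Continuous φ)
    (hc : HasCompactSupport φ) :
    Integrable (fun x => φ x • f x) (volume.restrict (Icc (0 : ℝ) l)) :=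
  (edge_integrable f).locallyIntegrable.integrable_smul_left_of_hasCompactSupport hφ hc

theorem IsWeakDeriv.add {l : ℝ} {f g f' g' : EdgeL2 l} (h : IsWeakDeriv l f g)
    (h' : IsWeakDeriv l f' g') : IsWeakDeriv l (f + f') (g + g') := by
  intro φ hφ hc hs
  have hd : Continuous (deriv φ) := hφ.continuous_deriv (by simp)
  have e1 : ∫ x in Icc 0 l, deriv φ x • (f + f') x
      = ∫ x in Icc 0 l, (deriv φ x • f x + deriv φ x • f' x) := by
    refine integral_congr_ae ?_
    filter_upwards [Lp.coeFn_add f f'] with x hx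
    rw [hx, Pi.add_apply, smul_add]
  have e2 : ∫ x in Icc 0 l, φ x • (g + g') x
      = ∫ x in Icc 0 l, (φ x • g x + φ x • g' x) := by
    refine integral_congr_ae ?_
    filter_upwards [Lp.coeFn_add g g'] with x hx
    rw [hx, Pi.add_apply, smul_add]
  rw [e1, e2, integral_add (edge_integrable_smul f hd hc.deriv)
    (edge_integrable_smul f' hd hc.deriv), integral_add (edge_integrable_smul g hφ.continuous hc)
    (edge_integrable_smul g' hφ.continuous hc), h φ hφ hc hs, h' φ hφ hc hs]
  ring

theorem IsWeakDeriv.smul {l : ℝ} {f g : EdgeL2 l} (c : ℂ) (h : IsWeakDeriv l f g) :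
    IsWeakDeriv l (c • f) (c • g) := by
  intro φ hφ hc hs
  have e1 : ∫ x in Icc 0 l, deriv φ x • (c • f) x = ∫ x in Icc 0 l, c • (deriv φ x • f x) := by
    refine integral_congr_ae ?_
    filter_upwards [Lp.coeFn_smul c f] with x hx
    simp only [hx, Pi.smul_apply]
    exact smul_comm _ _ _
  have e2 : ∫ x in Icc 0 l, φ x • (c • g) x = ∫ x in Icc 0 l, c • (φ x • g x) := by
    refine integral_congr_ae ?_
    filter_upwards [Lp.coeFn_smul c g] with x hx
    simp only [hx, Pi.smul_apply]
    exact smul_comm _ _ _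
  rw [e1, e2, integral_smul, integral_smul, h φ hφ hc hs, smul_neg]

theorem isWeakDeriv_zero (l : ℝ) : IsWeakDeriv l 0 0 := by
  intro φ _ _ _
  have e : ∀ ψ : ℝ → ℝ, ∫ x in Icc 0 l, ψ x • (0 : EdgeL2 l) x = 0 := by
    intro ψ
    rw [integral_congr_ae (g := fun _ => (0 : ℂ))]
    · simp
    · filter_upwards [Lp.coeFn_zero ℂ 2 (volume.restrict (Icc (0 : ℝ) l))] with x hx
      rw [hx, Pi.zero_apply, smul_zero]
  rw [e, e, neg_zero]

theorem ae_zero_of_test {l : ℝ} {h : ℝ → ℂ}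
    (hi : Integrable h (volume.restrict (Icc (0 : ℝ) l)))
    (H : ∀ φ : ℝ → ℝ, ContDiff ℝ ∞ φ → HasCompactSupport φ → tsupport φ ⊆ Ioo 0 l →
      ∫ x in Icc 0 l, φ x • h x = 0) :
    h =ᵐ[volume.restrict (Icc (0 : ℝ) l)] 0 := by
  have h0 := isOpen_Ioo.ae_eq_zero_of_integral_contDiff_smul_eq_zero
    (μ := volume.restrict (Icc (0 : ℝ) l)) (U := Ioo 0 l) (f := h)
    (hi.locallyIntegrable.locallyIntegrableOn _) H
  rw [← Measure.restrict_congr_set Ioo_ae_eq_Icc] at h0 ⊢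
  filter_upwards [h0, ae_restrict_mem measurableSet_Ioo] with x hx hm using hx hm

theorem IsWeakDeriv.unique {l : ℝ} {f g g' : EdgeL2 l} (h : IsWeakDeriv l f g)
    (h' : IsWeakDeriv l f g') : g = g' := by
  apply Lp.ext
  have : (fun x => g x - g' x) =ᵐ[volume.restrict (Icc (0 : ℝ) l)] 0 := by
    refine ae_zero_of_test ((edge_integrable g).sub (edge_integrable g')) ?_
    intro φ hφ hc hs
    have := (h φ hφ hc hs).symm.trans (h' φ hφ hc hs)
    simp only [smul_sub]
    rw [integral_sub (edge_integrable_smul g hφ.continuous hc)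
      (edge_integrable_smul g' hφ.continuous hc)]
    linear_combination -this
  filter_upwards [this] with x hx
  exact sub_eq_zero.mp hx

/-- A test function of integral zero is the derivative of a test function. -/
theorem exists_test_primitive {l : ℝ} {η : ℝ → ℝ} (hη : ContDiff ℝ ∞ η)
    (hc : HasCompactSupport η) (hs : tsupport η ⊆ Ioo 0 l) (h0 : ∫ x in Icc 0 l, η x = 0) :
    ∃ ψ : ℝ → ℝ, ContDiff ℝ ∞ ψ ∧ HasCompactSupport ψ ∧ tsupport ψ ⊆ Ioo 0 l ∧
      deriv ψ = η := by
  have hd : ∀ x, HasDerivAt (fun y => ∫ t in (0 : ℝ)..y, η t) (η x) x := fun x =>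
    intervalIntegral.integral_hasDerivAt_right (hη.continuous.intervalIntegrable _ _)
      (hη.continuous.stronglyMeasurableAtFilter _ _) hη.continuous.continuousAt
  have hderiv : deriv (fun y => ∫ t in (0 : ℝ)..y, η t) = η := funext fun x => (hd x).deriv
  have hz : ∀ x, x ∉ Ioo 0 l → η x = 0 := fun x hx =>
    image_eq_zero_of_notMem_tsupport fun h => hx (hs h)
  rcases (tsupport η).eq_empty_or_nonempty with he | hne
  · have : η = 0 := tsupport_eq_empty_iff.mp he
    subst this
    exact ⟨0, contDiff_const, HasCompactSupport.zero, by simp [tsupport], by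
      ext x; simp⟩
  have hcpt : IsCompact (tsupport η) := hc
  obtain ⟨a, haS, ha⟩ := hcpt.exists_isLeast hne
  obtain ⟨b, hbS, hb⟩ := hcpt.exists_isGreatest hne
  have ha0 := hs haS
  have hb0 := hs hbS
  have hzero : ∀ x, x ∉ Icc a b → ∫ t in (0 : ℝ)..x, η t = 0 := by
    intro x hx
    have hzo : ∀ t, t ∉ Icc a b → η t = 0 := fun t ht =>
      image_eq_zero_of_notMem_tsupport fun h => ht ⟨ha h, hb h⟩
    rcases lt_or_ge x a with hxa | hxa
    · rw [intervalIntegral.integral_congr (g := fun _ => (0 : ℝ))]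
      · simp
      · intro t ht
        apply hzo
        intro h'
        have : t ≤ max 0 x := ht.2
        have : t < a := lt_of_le_of_lt this (max_lt ha0.1 hxa)
        exact absurd h'.1 (not_le.mpr this)
    · have hbx : b < x := by
        by_contra h
        exact hx ⟨hxa, not_lt.mp h⟩
      have hl : (0 : ℝ) ≤ l := (ha0.1.trans ha0.2).le
      rw [integral_Icc_eq_integral_Ioc, ← intervalIntegral.integral_of_le hl] at h0
      rw [← intervalIntegral.integral_add_adjacent_intervals (b := l)
        (hη.continuous.intervalIntegrable _ _) (hη.continuous.intervalIntegrable _ _), h0, zero_add,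
        intervalIntegral.integral_congr (g := fun _ => (0 : ℝ))]
      · simp
      · intro t ht
        apply hzo
        intro h'
        have : min l x ≤ t := ht.1
        have : b < t := lt_of_lt_of_le (lt_min hb0.2 hbx) this
        exact absurd h'.2 (not_le.mpr this)
  have hsub : tsupport (fun y => ∫ t in (0 : ℝ)..y, η t) ⊆ Icc a b := by
    refine closure_minimal ?_ isClosed_Icc
    intro x hx
    by_contra h
    exact hx (hzero x h)
  refine ⟨fun y => ∫ t in (0 : ℝ)..y, η t, ?_, ?_, ?_, hderiv⟩
  · rw [contDiff_infty_iff_deriv, hderiv]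
    exact ⟨fun x => (hd x).differentiableAt, hη⟩
  · exact IsCompact.of_isClosed_subset isCompact_Icc (isClosed_tsupport _) hsub
  · exact hsub.trans fun x hx => ⟨ha0.1.trans_le hx.1, hx.2.trans_lt hb0.2⟩

/-- Integration by parts of a test function against a primitive of an `L²` function. -/
theorem test_parts {l : ℝ} (g : EdgeL2 l) {ψ : ℝ → ℝ} (hψ : ContDiff ℝ ∞ ψ)
    (hc : HasCompactSupport ψ) (hs : tsupport ψ ⊆ Ioo 0 l) :
    ∫ x in Icc 0 l, ψ x • g x
      = ∫ t in Icc 0 l, deriv ψ t • ∫ x in t..l, g x := by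
  set μ := volume.restrict (Icc (0 : ℝ) l) with hμ
  have hd : Continuous (deriv ψ) := hψ.continuous_deriv (by simp)
  have hK : Integrable (Function.uncurry fun t x : ℝ =>
      {p : ℝ × ℝ | p.1 < p.2}.indicator (fun p => deriv ψ p.1 • g p.2) (t, x)) (μ.prod μ) := by
    have : Integrable (fun p : ℝ × ℝ => deriv ψ p.1 • g p.2) (μ.prod μ) := by
      refine Integrable.smul_prod ?_ (edge_integrable g)
      exact (hd.integrable_of_hasCompactSupport hc.deriv).restrict
    exact this.indicator (measurableSet_lt measurable_fst measurable_snd)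
  have hsw := integral_integral_swap hK
  have e1 : ∀ᵐ x ∂μ, ∫ t, {p : ℝ × ℝ | p.1 < p.2}.indicator
      (fun p => deriv ψ p.1 • g p.2) (t, x) ∂μ = ψ x • g x := by
    filter_upwards [ae_restrict_mem measurableSet_Icc] with x hx
    have : (fun t => {p : ℝ × ℝ | p.1 < p.2}.indicator
        (fun p => deriv ψ p.1 • g p.2) (t, x))
        = (Iio x).indicator fun t => deriv ψ t • g x := by
      ext t; simp [indicator]
    rw [this, integral_indicator measurableSet_Iio, hμ, Measure.restrict_restrict measurableSet_Iio,
      integral_smul_const]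
    have hset : Iio x ∩ Icc 0 l = Ico 0 x := by
      ext t; simp only [mem_inter_iff, mem_Iio, mem_Icc, mem_Ico]
      constructor
      · rintro ⟨h1, h2, _⟩; exact ⟨h2, h1⟩
      · rintro ⟨h1, h2⟩; exact ⟨h2, h1, h2.le.trans hx.2⟩
    rw [hset, integral_Ico_eq_integral_Ioc, ← intervalIntegral.integral_of_le hx.1,
      intervalIntegral.integral_deriv_eq_sub (fun t _ => (hψ.differentiable (by simp)) t)
        (hd.intervalIntegrable _ _)]
    have : ψ 0 = 0 := image_eq_zero_of_notMem_tsupport fun h => lt_irrefl _ (hs h).1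
    simp [this]
  have e2 : ∀ᵐ t ∂μ, ∫ x, {p : ℝ × ℝ | p.1 < p.2}.indicator
      (fun p => deriv ψ p.1 • g p.2) (t, x) ∂μ = deriv ψ t • ∫ x in t..l, g x := by
    filter_upwards [ae_restrict_mem measurableSet_Icc] with t ht
    have : (fun x => {p : ℝ × ℝ | p.1 < p.2}.indicator
        (fun p => deriv ψ p.1 • g p.2) (t, x))
        = (Ioi t).indicator fun x => deriv ψ t • g x := by
      ext x; simp [indicator]
    rw [this, integral_indicator measurableSet_Ioi, hμ, Measure.restrict_restrict measurableSet_Ioi,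
      integral_smul]
    have hset : Ioi t ∩ Icc 0 l = Ioc t l := by
      ext x; simp only [mem_inter_iff, mem_Ioi, mem_Icc, mem_Ioc]
      constructor
      · rintro ⟨h1, _, h3⟩; exact ⟨h1, h3⟩
      · rintro ⟨h1, h2⟩; exact ⟨h1, ht.1.trans h1.le, h2⟩
    rw [hset, ← intervalIntegral.integral_of_le ht.2]
  rw [← integral_congr_ae e1, ← integral_congr_ae e2]
  exact hsw.symm

/-- One-dimensional Sobolev embedding: a function with a weak derivative in `L²` has a continuous
representative on the closed edge, so that its boundary values make sense. -/
theorem IsWeakDeriv.exists_continuous {l : ℝ} (hl : 0 < l) {f g : EdgeL2 l}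
    (h : IsWeakDeriv l f g) :
    ∃ u : ℝ → ℂ, ContinuousOn u (Icc 0 l) ∧ f =ᵐ[volume.restrict (Icc (0 : ℝ) l)] u := by
  set G : ℝ → ℂ := fun t => ∫ x in t..l, g x with hG
  have hgi : IntegrableOn g (uIcc 0 l) := by
    rw [uIcc_of_le hl.le]; exact edge_integrable g
  have hGc : ContinuousOn G (Icc 0 l) := by
    have := intervalIntegral.continuousOn_primitive_interval_left (μ := volume)
      (f := g) (a := 0) (b := l) hgi
    rwa [uIcc_of_le hl.le] at this
  have hGi : Integrable G (volume.restrict (Icc (0 : ℝ) l)) := hGc.integrableOn_Icc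
  obtain ⟨χ, hχs, hχc, hχd, hχr, hχ1⟩ := exists_contDiff_tsupport_subset (n := ⊤)
    (isOpen_Ioo.mem_nhds (show l / 2 ∈ Ioo 0 l from ⟨by linarith, by linarith⟩))
  have hpos : 0 < ∫ x in Icc 0 l, χ x := by
    rw [setIntegral_eq_integral_of_forall_compl_eq_zero fun x hx =>
      image_eq_zero_of_notMem_tsupport fun h => hx (Ioo_subset_Icc_self (hχs h))]
    refine hχd.continuous.integral_pos_of_hasCompactSupport_nonneg_nonzero hχc
      (fun x => (hχr ⟨x, rfl⟩).1) (x := l / 2) ?_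
    rw [hχ1]; exact one_ne_zero
  set M : ℝ := ∫ x in Icc 0 l, χ x with hM
  set H : ℝ → ℂ := fun x => f x + G x with hH
  have hHi : Integrable H (volume.restrict (Icc (0 : ℝ) l)) := (edge_integrable f).add hGi
  have hsm : ∀ {φ : ℝ → ℝ} {k : ℝ → ℂ}, Continuous φ → HasCompactSupport φ →
      Integrable k (volume.restrict (Icc (0 : ℝ) l)) →
      Integrable (fun x => φ x • k x) (volume.restrict (Icc (0 : ℝ) l)) := fun hφ hc hk =>
    hk.locallyIntegrable.integrable_smul_left_of_hasCompactSupport hφ hc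
  set C : ℂ := M⁻¹ • ∫ x in Icc 0 l, χ x • H x with hC
  have key : (fun x => H x - C) =ᵐ[volume.restrict (Icc (0 : ℝ) l)] 0 := by
    refine ae_zero_of_test (hHi.sub (integrable_const C)) ?_
    intro φ hφ hc hs
    set m : ℝ := (∫ x in Icc 0 l, φ x) * M⁻¹ with hm
    have hφi : Integrable φ (volume.restrict (Icc (0 : ℝ) l)) :=
      (hφ.continuous.integrable_of_hasCompactSupport hc).restrict
    have hχi : Integrable χ (volume.restrict (Icc (0 : ℝ) l)) :=
      (hχd.continuous.integrable_of_hasCompactSupport hχc).restrict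
    have hmχ : HasCompactSupport fun x => m * χ x := hχc.mul_left
    obtain ⟨ψ, hψ, hψc, hψs, hψd⟩ := exists_test_primitive (l := l)
      (η := fun x => φ x - m * χ x) (hφ.sub (contDiff_const.mul hχd)) (hc.sub hmχ)
      ((tsupport_sub φ fun x => m * χ x).trans
        (union_subset hs ((closure_mono (Function.support_mul_subset_right _ _)).trans hχs)))
      (by
        rw [integral_sub hφi (hχi.const_mul m), integral_const_mul, ← hM, hm,
          inv_mul_cancel_right₀ hpos.ne', sub_self])
    have h1 := h ψ hψ hψc hψs
    rw [test_parts g hψ hψc hψs] at h1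
    have hdc : Continuous (deriv ψ) := hψ.continuous_deriv (by simp)
    have h2 : ∫ x in Icc 0 l, deriv ψ x • H x = 0 := by
      simp only [hH, smul_add]
      rw [integral_add (hsm hdc hψc.deriv (edge_integrable f)) (hsm hdc hψc.deriv hGi), h1]
      simp only [hG, neg_add_cancel]
    rw [hψd] at h2
    simp only [sub_smul, mul_smul] at h2
    have hmi : Integrable (fun x => m • χ x • H x) (volume.restrict (Icc (0 : ℝ) l)) :=
      (hsm hχd.continuous hχc hHi).smul m
    rw [integral_sub (hsm hφ.continuous hc hHi) hmi, integral_smul] at h2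
    simp only [smul_sub]
    rw [integral_sub (hsm hφ.continuous hc hHi) (hsm hφ.continuous hc (integrable_const C)),
      integral_smul_const, hC, ← mul_smul]
    exact h2
  refine ⟨fun x => C - G x, continuousOn_const.sub hGc, ?_⟩
  filter_upwards [key] with x hx
  have : f x + G x - C = 0 := hx
  linear_combination this

open Classical in
/-- The weak derivative of `f` (unique when it exists; `0` when there is none). -/
def weakDeriv {l : ℝ} (f : EdgeL2 l) : EdgeL2 l :=
  if h : ∃ g, IsWeakDeriv l f g then h.choose else 0

theorem IsWeakDeriv.weakDeriv_eq {l : ℝ} {f g : EdgeL2 l} (h : IsWeakDeriv l f g) :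
    weakDeriv f = g := by
  have hex : ∃ g, IsWeakDeriv l f g := ⟨g, h⟩
  rw [weakDeriv, dif_pos hex]
  exact hex.choose_spec.unique h

/-- The Sobolev space `H²([0, l])`: functions in `L²` with two weak derivatives in `L²`. -/
def H2 (l : ℝ) : Submodule ℂ (EdgeL2 l) where
  carrier := {f | ∃ g h, IsWeakDeriv l f g ∧ IsWeakDeriv l g h}
  zero_mem' := ⟨0, 0, isWeakDeriv_zero l, isWeakDeriv_zero l⟩
  add_mem' := by
    rintro f f' ⟨g, h, hg, hh⟩ ⟨g', h', hg', hh'⟩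
    exact ⟨g + g', h + h', hg.add hg', hh.add hh'⟩
  smul_mem' := by
    rintro c f ⟨g, h, hg, hh⟩
    exact ⟨c • g, c • h, hg.smul c, hh.smul c⟩

/-- `u` is a representative of the class `f` that is continuous on `[0, l]`. -/
def IsContRep {l : ℝ} (f : EdgeL2 l) (u : ℝ → ℂ) : Prop :=
  ContinuousOn u (Icc 0 l) ∧ f =ᵐ[volume.restrict (Icc (0 : ℝ) l)] u

open Classical in
/-- The continuous representative of `f` (unique on `[0, l]` when it exists; `0` when there is
none). Evaluating it gives the pointwise values of a function in `H²([0, l])`. -/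
def contRep {l : ℝ} (f : EdgeL2 l) : ℝ → ℂ :=
  if h : ∃ u, IsContRep f u then h.choose else 0

theorem IsContRep.contRep_eq {l : ℝ} (hl : 0 < l) {f : EdgeL2 l} {u : ℝ → ℂ}
    (h : IsContRep f u) : EqOn (contRep f) u (Icc 0 l) := by
  have hex : ∃ u, IsContRep f u := ⟨u, h⟩
  rw [contRep, dif_pos hex]
  exact Measure.eqOn_Icc_of_ae_eq volume hl.ne (hex.choose_spec.2.symm.trans h.2)
    hex.choose_spec.1 h.1

theorem IsContRep.add {l : ℝ} {f f' : EdgeL2 l} {u u' : ℝ → ℂ} (h : IsContRep f u)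
    (h' : IsContRep f' u') : IsContRep (f + f') (u + u') :=
  ⟨h.1.add h'.1, (Lp.coeFn_add f f').trans (h.2.add h'.2)⟩

theorem IsContRep.smul {l : ℝ} {f : EdgeL2 l} {u : ℝ → ℂ} (c : ℂ) (h : IsContRep f u) :
    IsContRep (c • f) (c • u) :=
  ⟨h.1.const_smul c, (Lp.coeFn_smul c f).trans (h.2.const_smul c)⟩

theorem isContRep_contRep {l : ℝ} (hl : 0 < l) {f g : EdgeL2 l} (h : IsWeakDeriv l f g) :
    IsContRep f (contRep f) := by
  have hex : ∃ u, IsContRep f u := h.exists_continuous hl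
  rw [contRep, dif_pos hex]
  exact hex.choose_spec

/-- The value `f x` of (the continuous representative of) `f` at `x`, and that of `f'`, are
additive and homogeneous on `H²`. -/
theorem H2.contRep_add {l : ℝ} (hl : 0 < l) {f f' : EdgeL2 l} (hf : f ∈ H2 l) (hf' : f' ∈ H2 l)
    {x : ℝ} (hx : x ∈ Icc 0 l) :
    contRep (f + f') x = contRep f x + contRep f' x ∧
      contRep (weakDeriv (f + f')) x = contRep (weakDeriv f) x + contRep (weakDeriv f') x := by
  obtain ⟨g, h, hg, hh⟩ := hf
  obtain ⟨g', h', hg', hh'⟩ := hf'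
  rw [(hg.add hg').weakDeriv_eq, hg.weakDeriv_eq, hg'.weakDeriv_eq]
  exact ⟨((isContRep_contRep hl hg).add (isContRep_contRep hl hg')).contRep_eq hl hx,
    ((isContRep_contRep hl hh).add (isContRep_contRep hl hh')).contRep_eq hl hx⟩

theorem H2.contRep_smul {l : ℝ} (hl : 0 < l) (c : ℂ) {f : EdgeL2 l} (hf : f ∈ H2 l)
    {x : ℝ} (hx : x ∈ Icc 0 l) :
    contRep (c • f) x = c * contRep f x ∧
      contRep (weakDeriv (c • f)) x = c * contRep (weakDeriv f) x := by
  obtain ⟨g, h, hg, hh⟩ := hf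
  rw [(hg.smul c).weakDeriv_eq, hg.weakDeriv_eq]
  exact ⟨((isContRep_contRep hl hg).smul c).contRep_eq hl hx,
    ((isContRep_contRep hl hh).smul c).contRep_eq hl hx⟩

theorem H2.contRep_zero {l : ℝ} (hl : 0 < l) {x : ℝ} (hx : x ∈ Icc 0 l) :
    contRep (0 : EdgeL2 l) x = 0 ∧ contRep (weakDeriv (0 : EdgeL2 l)) x = 0 := by
  have := H2.contRep_smul hl 0 (zero_mem (H2 l)) hx
  simpa only [zero_smul, zero_mul] using this

/-- A function in `H²` times an `L²` potential is in `L²`. -/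
theorem H2.memLp_mul {l : ℝ} (hl : 0 < l) {V : ℝ → ℂ}
    (hV : MemLp V 2 (volume.restrict (Icc (0 : ℝ) l))) {f : EdgeL2 l} (hf : f ∈ H2 l) :
    MemLp (fun x => V x * f x) 2 (volume.restrict (Icc (0 : ℝ) l)) := by
  obtain ⟨g, h, hg, -⟩ := hf
  obtain ⟨u, hu, hfu⟩ := hg.exists_continuous hl
  obtain ⟨C, hC⟩ := isCompact_Icc.exists_bound_of_continuousOn hu
  have hbd : ∀ᵐ x ∂volume.restrict (Icc (0 : ℝ) l), ‖f x‖ ≤ C := by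
    filter_upwards [hfu, ae_restrict_mem measurableSet_Icc] with x hx hm
    rw [hx]
    exact hC x hm
  have hfi : MemLp f ∞ (volume.restrict (Icc (0 : ℝ) l)) :=
    memLp_top_of_bound (Lp.aestronglyMeasurable f) C hbd
  exact hfi.mul' hV

/-- The Schrödinger operator `f ↦ -f'' + V f` on one edge, from `H²([0, l])` to `L²([0, l])`. -/
def edgeOp {l : ℝ} (hl : 0 < l) {V : ℝ → ℂ}
    (hV : MemLp V 2 (volume.restrict (Icc (0 : ℝ) l))) : H2 l →ₗ[ℂ] EdgeL2 l where
  toFun f := - weakDeriv (weakDeriv (f : EdgeL2 l)) + (H2.memLp_mul hl hV f.2).toLp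
  map_add' := by
    rintro ⟨f, hf⟩ ⟨f', hf'⟩
    have e : (H2.memLp_mul hl hV (add_mem hf hf')).toLp =
        (H2.memLp_mul hl hV hf).toLp + (H2.memLp_mul hl hV hf').toLp := by
      rw [← MemLp.toLp_add]
      refine MemLp.toLp_congr _ _ ?_
      filter_upwards [Lp.coeFn_add f f'] with x hx
      rw [hx, Pi.add_apply, Pi.add_apply, mul_add]
    obtain ⟨g, h, hg, hh⟩ := id hf
    obtain ⟨g', h', hg', hh'⟩ := id hf'
    change - weakDeriv (weakDeriv (f + f')) + (H2.memLp_mul hl hV (add_mem hf hf')).toLp = _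
    rw [e, (hg.add hg').weakDeriv_eq, (hh.add hh').weakDeriv_eq, hg.weakDeriv_eq,
      hh.weakDeriv_eq, hg'.weakDeriv_eq, hh'.weakDeriv_eq]
    abel
  map_smul' := by
    rintro c ⟨f, hf⟩
    have e : (H2.memLp_mul hl hV ((H2 l).smul_mem c hf)).toLp =
        c • (H2.memLp_mul hl hV hf).toLp := by
      rw [← MemLp.toLp_const_smul]
      refine MemLp.toLp_congr _ _ ?_
      filter_upwards [Lp.coeFn_smul c f] with x hx
      rw [hx, Pi.smul_apply, Pi.smul_apply, smul_eq_mul, smul_eq_mul, mul_left_comm]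
    obtain ⟨g, h, hg, hh⟩ := id hf
    change - weakDeriv (weakDeriv (c • f)) + (H2.memLp_mul hl hV ((H2 l).smul_mem c hf)).toLp = _
    rw [e, (hg.smul c).weakDeriv_eq, (hh.smul c).weakDeriv_eq, hg.weakDeriv_eq,
      hh.weakDeriv_eq, RingHom.id_apply, smul_add, smul_neg]

/-- `L²` of a metric graph with edge set `E` and edge lengths `len`: the Hilbert direct sum of
the spaces `L²([0, len e])`. -/
abbrev GraphL2 {E : Type*} (len : E → ℝ) : Type _ := PiLp 2 fun e => EdgeL2 (len e)

/-- A quantum graph with (directed) edge set `E`: edge lengths, a potential on each edge that is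
square integrable (in particular any bounded measurable potential is allowed), and matrices
`A`, `B` that encode the vertex conditions. The index `(e, 0)` is the initial end `x = 0` of the
edge `e`, the index `(e, 1)` its terminal end `x = len e`. -/
structure QuantumGraph (E : Type*) where
  len : E → ℝ
  len_pos : ∀ e, 0 < len e
  pot : E → ℝ → ℂ
  pot_memLp : ∀ e, MemLp (pot e) 2 (volume.restrict (Icc (0 : ℝ) (len e)))
  A : Matrix (E × Fin 2) (E × Fin 2) ℂ
  B : Matrix (E × Fin 2) (E × Fin 2) ℂ

namespace QuantumGraph

variable {E : Type*} (Γ : QuantumGraph E)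

/-- Dirichlet trace: the values at the edge ends. -/
def traceD (f : GraphL2 Γ.len) : E × Fin 2 → ℂ := fun p =>
  if p.2 = 0 then contRep (f p.1) 0 else contRep (f p.1) (Γ.len p.1)

/-- Neumann trace: the inward derivatives at the edge ends. -/
def traceN (f : GraphL2 Γ.len) : E × Fin 2 → ℂ := fun p =>
  if p.2 = 0 then contRep (weakDeriv (f p.1)) 0 else - contRep (weakDeriv (f p.1)) (Γ.len p.1)

theorem trace_add {f f' : GraphL2 Γ.len} (hf : ∀ e, f e ∈ H2 (Γ.len e))
    (hf' : ∀ e, f' e ∈ H2 (Γ.len e)) :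
    Γ.traceD (f + f') = Γ.traceD f + Γ.traceD f' ∧
      Γ.traceN (f + f') = Γ.traceN f + Γ.traceN f' := by
  have h0 := fun e => H2.contRep_add (Γ.len_pos e) (hf e) (hf' e)
    (left_mem_Icc.mpr (Γ.len_pos e).le)
  have h1 := fun e => H2.contRep_add (Γ.len_pos e) (hf e) (hf' e)
    (right_mem_Icc.mpr (Γ.len_pos e).le)
  constructor <;> ext ⟨e, i⟩
  · simp only [traceD, Pi.add_apply, PiLp.add_apply, (h0 e).1, (h1 e).1]
    split_ifs <;> rfl
  · simp only [traceN, Pi.add_apply, PiLp.add_apply, (h0 e).2, (h1 e).2, neg_add]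
    split_ifs <;> rfl

theorem trace_smul (c : ℂ) {f : GraphL2 Γ.len} (hf : ∀ e, f e ∈ H2 (Γ.len e)) :
    Γ.traceD (c • f) = c • Γ.traceD f ∧ Γ.traceN (c • f) = c • Γ.traceN f := by
  have h0 := fun e => H2.contRep_smul (Γ.len_pos e) c (hf e)
    (left_mem_Icc.mpr (Γ.len_pos e).le)
  have h1 := fun e => H2.contRep_smul (Γ.len_pos e) c (hf e)
    (right_mem_Icc.mpr (Γ.len_pos e).le)
  constructor <;> ext ⟨e, i⟩
  · simp only [traceD, Pi.smul_apply, PiLp.smul_apply, (h0 e).1, (h1 e).1, smul_eq_mul]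
    split_ifs <;> rfl
  · simp only [traceN, Pi.smul_apply, PiLp.smul_apply, (h0 e).2, (h1 e).2, smul_eq_mul, mul_ite,
      mul_neg]

/-- The domain of the Schrödinger operator: functions that are in `H²` on every edge and satisfy
the vertex conditions `A γ_D(f) + B γ_N(f) = 0`. It carries the inner product of `L²`. -/
def domain [Fintype E] : Submodule ℂ (GraphL2 Γ.len) where
  carrier := {f | (∀ e, f e ∈ H2 (Γ.len e)) ∧
    Γ.A.mulVec (Γ.traceD f) + Γ.B.mulVec (Γ.traceN f) = 0}
  zero_mem' := by
    have h := Γ.trace_smul 0 (f := 0) fun e => zero_mem (H2 (Γ.len e))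
    simp only [zero_smul] at h
    refine ⟨fun e => zero_mem (H2 (Γ.len e)), ?_⟩
    rw [h.1, h.2, Matrix.mulVec_zero, Matrix.mulVec_zero, add_zero]
  add_mem' := by
    rintro f f' ⟨hf, hv⟩ ⟨hf', hv'⟩
    refine ⟨fun e => add_mem (hf e) (hf' e), ?_⟩
    rw [(Γ.trace_add hf hf').1, (Γ.trace_add hf hf').2, Matrix.mulVec_add, Matrix.mulVec_add,
      add_add_add_comm, hv, hv', add_zero]
  smul_mem' := by
    rintro c f ⟨hf, hv⟩
    refine ⟨fun e => (H2 (Γ.len e)).smul_mem c (hf e), ?_⟩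
    rw [(Γ.trace_smul c hf).1, (Γ.trace_smul c hf).2, Matrix.mulVec_smul, Matrix.mulVec_smul,
      ← smul_add, hv, smul_zero]

/-- The Schrödinger operator `f ↦ -f'' + V f`, applied edge by edge, from its domain to `L²`. -/
def op [Fintype E] : Γ.domain →ₗ[ℂ] GraphL2 Γ.len where
  toFun f := WithLp.toLp 2 fun e =>
    edgeOp (Γ.len_pos e) (Γ.pot_memLp e) ⟨(f : GraphL2 Γ.len) e, f.2.1 e⟩
  map_add' f f' := by
    ext1 e
    exact (edgeOp (Γ.len_pos e) (Γ.pot_memLp e)).map_add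
      ⟨(f : GraphL2 Γ.len) e, f.2.1 e⟩ ⟨(f' : GraphL2 Γ.len) e, f'.2.1 e⟩
  map_smul' c f := by
    ext1 e
    exact (edgeOp (Γ.len_pos e) (Γ.pot_memLp e)).map_smul c ⟨(f : GraphL2 Γ.len) e, f.2.1 e⟩

end QuantumGraph

/-- The natural identification of `L²` of two edges of the same length, and zero if the lengths
differ. -/
def edgeTransport (l l' : ℝ) : EdgeL2 l →ₗ[ℂ] EdgeL2 l' :=
  if h : l = l' then h ▸ LinearMap.id else 0

/-- The action of a numerical matrix `T` on families of functions on edges: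
`(T f)_k = ∑ j, T k j • f j`, where functions on edges of the same length are identified. It is
meant for matrices whose nonzero entries only relate edges of equal length. -/
def matrixAction {m n : Type*} [Fintype n] (len : n → ℝ) (len' : m → ℝ) (T : Matrix m n ℂ) :
    GraphL2 len →ₗ[ℂ] GraphL2 len' where
  toFun f := WithLp.toLp 2 fun k => ∑ j, T k j • edgeTransport (len j) (len' k) (f j)
  map_add' f f' := by
    ext1 k
    simp only [PiLp.add_apply, map_add, smul_add, Finset.sum_add_distrib]
  map_smul' c f := by
    ext1 k
    simp only [PiLp.smul_apply, map_smul, Finset.smul_sum, RingHom.id_apply, smul_comm c]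

section Symmetry

variable {G : Type*} [Group G] {E : Type*} [MulAction G E]

/-- The action of `g` on functions on the graph: it takes the function on an edge `e` and places
it on the edge `g e`, that is `(π(g) f)_e = f_{g⁻¹ e}`. -/
def edgeAction (len : E → ℝ) (g : G) : GraphL2 len →ₗ[ℂ] GraphL2 len where
  toFun f := WithLp.toLp 2 fun e => edgeTransport (len (g⁻¹ • e)) (len e) (f (g⁻¹ • e))
  map_add' f f' := by
    ext1 k
    simp only [PiLp.add_apply, map_add]
  map_smul' c f := by
    ext1 k
    simp only [PiLp.smul_apply, map_smul, RingHom.id_apply]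

/-- The permutation matrix `π(g)`, with `π(g) e_j = e_{g j}` on the standard basis. -/
def permMatrix (E : Type*) [DecidableEq E] [MulAction G E] (g : G) : Matrix E E ℂ :=
  Matrix.of fun i j => if i = g • j then 1 else 0

/-- The doubled permutation matrix `π(g) ⊗ I₂`, which acts on the edge ends. -/
def permMatrixHat (E : Type*) [DecidableEq E] [MulAction G E] (g : G) :
    Matrix (E × Fin 2) (E × Fin 2) ℂ :=
  permMatrix E g ⊗ₖ (1 : Matrix (Fin 2) (Fin 2) ℂ)

/-- The quantum graph is `π`-symmetric: lengths and potentials are preserved, and the vertex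
conditions are preserved. -/
structure IsPiSymmetric (G : Type*) [Group G] {E : Type*} [Fintype E] [DecidableEq E]
    [MulAction G E] (Γ : QuantumGraph E) : Prop where
  len_smul : ∀ (g : G) (e : E), Γ.len (g • e) = Γ.len e
  pot_smul : ∀ (g : G) (e : E),
    Γ.pot (g • e) =ᵐ[volume.restrict (Icc (0 : ℝ) (Γ.len e))] Γ.pot e
  vertex : ∀ (g : G) (F F' : E × Fin 2 → ℂ),
    Γ.A.mulVec F + Γ.B.mulVec F' = 0 ↔
      Γ.A.mulVec ((permMatrixHat E g).mulVec F) + Γ.B.mulVec ((permMatrixHat E g).mulVec F') = 0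

variable {r : ℕ} (ρ : G →* GL (Fin r) ℂ)

/-- The kernel space `⋂_g ker (I_r ⊗ π(g) - ρ(g)ᵀ ⊗ I)` in `ℂ^r ⊗ ℂ^E`. -/
def kernelSpace (E : Type*) [Fintype E] [DecidableEq E] [MulAction G E] :
    Submodule ℂ (EuclideanSpace ℂ (Fin r × E)) :=
  ⨅ g : G, LinearMap.ker (Matrix.toEuclideanLin
    ((1 : Matrix (Fin r) (Fin r) ℂ) ⊗ₖ permMatrix E g -
      ((ρ g : GL (Fin r) ℂ) : Matrix (Fin r) (Fin r) ℂ).transpose ⊗ₖ (1 : Matrix E E ℂ)))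

/-- The subspace `V_ρ ⊗ X_i` of `ℂ^r ⊗ ℂ^E` of vectors supported on the orbit of the edge `i`. -/
def orbitSupported (G : Type*) [Group G] {E : Type*} [MulAction G E] (r : ℕ) (i : E) :
    Submodule ℂ (EuclideanSpace ℂ (Fin r × E)) where
  carrier := {x | ∀ p : Fin r × E, p.2 ∉ MulAction.orbit G i → x p = 0}
  zero_mem' := fun _ _ => rfl
  add_mem' := fun {x y} hx hy p hp => by rw [PiLp.add_apply, hx p hp, hy p hp, add_zero]
  smul_mem' := fun c x hx p hp => by rw [PiLp.smul_apply, hx p hp, smul_zero]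

/-- The part of the kernel space supported on the orbit of the edge `i`. -/
def orbitKernelSpace [Fintype E] [DecidableEq E] (i : E) :
    Submodule ℂ (EuclideanSpace ℂ (Fin r × E)) :=
  kernelSpace ρ E ⊓ orbitSupported G r i

/-- `D` is a fundamental domain: it contains precisely one edge of each orbit. -/
def IsFundamentalDomain (G : Type*) [Group G] {E : Type*} [MulAction G E] (D : Finset E) : Prop :=
  ∀ e : E, ∃! i, i ∈ D ∧ e ∈ MulAction.orbit G i

variable [Fintype E] [DecidableEq E]

/-- The edges `e_{i,j}` of the quotient graph: `i` in the fundamental domain and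
`j = 1, …, d_i`, where `d_i` is the dimension of the part of the kernel space supported on the
orbit of `i`. -/
abbrev QuotientEdge (D : Finset E) : Type _ :=
  Σ i : D, Fin (Module.finrank ℂ (orbitKernelSpace ρ (i : E)))

/-- A choice, for each `i` in the fundamental domain, of an orthonormal basis of the part of the
kernel space supported on the orbit of `i`. -/
abbrev OrbitBasis (D : Finset E) : Type _ :=
  (i : D) → OrthonormalBasis (Fin (Module.finrank ℂ (orbitKernelSpace ρ (i : E)))) ℂ
    (orbitKernelSpace ρ (i : E))

variable {ρ} {D : Finset E}

/-- The matrix `Θ = (Θ_1, …, Θ_{|D|})` whose columns are the vectors of the chosen bases. -/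
def theta (b : OrbitBasis ρ D) : Matrix (Fin r × E) (QuotientEdge ρ D) ℂ :=
  Matrix.of fun p q => (b q.1 q.2 : EuclideanSpace ℂ (Fin r × E)) p

/-- The doubled matrix `Θ ⊗ I₂`. -/
def thetaHat (b : OrbitBasis ρ D) :
    Matrix (Fin r × (E × Fin 2)) (QuotientEdge ρ D × Fin 2) ℂ :=
  (theta b ⊗ₖ (1 : Matrix (Fin 2) (Fin 2) ℂ)).submatrix
    (Equiv.prodAssoc (Fin r) E (Fin 2)).symm id

/-- The matrix `Θ̂* (I_r ⊗ M) Θ̂`. -/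
def compress (b : OrbitBasis ρ D) (M : Matrix (E × Fin 2) (E × Fin 2) ℂ) :
    Matrix (QuotientEdge ρ D × Fin 2) (QuotientEdge ρ D × Fin 2) ℂ :=
  (thetaHat b).conjTranspose * ((1 : Matrix (Fin r) (Fin r) ℂ) ⊗ₖ M) * thetaHat b

/-- The quotient graph `Γ_ρ`: the edge `e_{i,j}` has the length and potential of `i`, and the
vertex conditions are `A_ρ = Θ̂* (I_r ⊗ A) Θ̂` and `B_ρ = Θ̂* (I_r ⊗ B) Θ̂`. -/
def quotientGraph (Γ : QuantumGraph E) (b : OrbitBasis ρ D) :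
    QuantumGraph (QuotientEdge ρ D) where
  len q := Γ.len q.1
  len_pos q := Γ.len_pos q.1
  pot q := Γ.pot q.1
  pot_memLp q := Γ.pot_memLp q.1
  A := compress b Γ.A
  B := compress b Γ.B

/-- The `k`-th column `φ^(k) = (f_{(k,e)})_e` of a family of functions indexed by `Fin r × E`. -/
def column {E : Type*} (len : E → ℝ) {r : ℕ} (k : Fin r) :
    GraphL2 (fun p : Fin r × E => len p.2) →ₗ[ℂ] GraphL2 len where
  toFun f := WithLp.toLp 2 fun e => f (k, e)
  map_add' _ _ := rfl
  map_smul' _ _ := rfl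

/-- `vec⁻¹` for families of functions indexed by `Fin r × E`: the row `(φ^(1), …, φ^(r))` of the
columns of `f`, regarded as the linear map `V_ρ = ℂ^r → L²`, `v ↦ ∑ k, v k • φ^(k)`. -/
def unvec {E : Type*} (len : E → ℝ) (r : ℕ) :
    GraphL2 (fun p : Fin r × E => len p.2) →ₗ[ℂ] ((Fin r → ℂ) →ₗ[ℂ] GraphL2 len) where
  toFun f :=
    { toFun := fun v => ∑ k, v k • column len k f
      map_add' := fun v w => by simp only [Pi.add_apply, add_smul, Finset.sum_add_distrib]
      map_smul' := fun c v => by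
        simp only [Pi.smul_apply, smul_assoc, Finset.smul_sum, RingHom.id_apply] }
  map_add' f f' := by
    refine LinearMap.ext fun v => ?_
    simp only [LinearMap.coe_mk, AddHom.coe_mk, LinearMap.add_apply, map_add, smul_add,
      Finset.sum_add_distrib]
  map_smul' c f := by
    refine LinearMap.ext fun v => ?_
    simp only [LinearMap.coe_mk, AddHom.coe_mk, LinearMap.smul_apply, map_smul, Finset.smul_sum,
      RingHom.id_apply, smul_comm c]

/-- The map `vec⁻¹ ∘ Θ` from `L²(Γ_ρ)` to linear maps `V_ρ → L²(Γ)`. -/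
def unvecTheta (Γ : QuantumGraph E) (b : OrbitBasis ρ D) :
    GraphL2 (quotientGraph Γ b).len →ₗ[ℂ] ((Fin r → ℂ) →ₗ[ℂ] GraphL2 Γ.len) :=
  unvec Γ.len r ∘ₗ matrixAction (quotientGraph Γ b).len (fun p : Fin r × E => Γ.len p.2) (theta b)

end Symmetry

/-- `Hom_G(V_ρ, W)` for a subspace `W` of `L²(Γ)`: the linear maps `φ : V_ρ = ℂ^r → L²(Γ)` with
values in `W` that satisfy `π(g) φ = φ ρ(g)` for all `g`. -/
def homG {G : Type*} [Group G] {E : Type*} [MulAction G E] (Γ : QuantumGraph E) {r : ℕ}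
    (ρ : G →* GL (Fin r) ℂ) (W : Submodule ℂ (GraphL2 Γ.len)) :
    Submodule ℂ ((Fin r → ℂ) →ₗ[ℂ] GraphL2 Γ.len) where
  carrier := {φ | (∀ (g : G) (v : Fin r → ℂ), edgeAction Γ.len g (φ v) =
    φ (((ρ g : GL (Fin r) ℂ) : Matrix (Fin r) (Fin r) ℂ).mulVec v)) ∧ ∀ v, φ v ∈ W}
  zero_mem' := ⟨fun g v => by simp only [LinearMap.zero_apply, map_zero], fun _ => zero_mem W⟩
  add_mem' := fun h h' => ⟨fun g v => by simp only [LinearMap.add_apply, map_add, h.1, h'.1],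
    fun v => add_mem (h.2 v) (h'.2 v)⟩
  smul_mem' := fun c φ h => ⟨fun g v => by simp only [LinearMap.smul_apply, map_smul, h.1],
    fun v => W.smul_mem c (h.2 v)⟩

/-- The scalar product `Tr(φ* ψ) = ∑ k, ⟨φ^(k), ψ^(k)⟩` of two maps `V_ρ = ℂ^r → L²(Γ)`. -/
def homInner {E : Type*} [Fintype E] {len : E → ℝ} {r : ℕ}
    (φ ψ : (Fin r → ℂ) →ₗ[ℂ] GraphL2 len) : ℂ :=
  ∑ k, ⟪φ (Pi.single k 1), ψ (Pi.single k 1)⟫_ℂ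

/-- `Γ'` is a quotient of `Γ` by `ρ` (without any requirement on inner products): there are
linear isomorphisms `Dom(Op') ≅ Hom_G(V_ρ, Dom(Op))` and `L²(Γ') ≅ Hom_G(V_ρ, L²(Γ))` that form a
commutative diagram with `Op'` and `φ ↦ Op ∘ φ`. -/
def IsQuotientGraph {G : Type*} [Group G] {E : Type*} [Fintype E] [MulAction G E]
    (Γ : QuantumGraph E) {r : ℕ} (ρ : G →* GL (Fin r) ℂ) {E' : Type*} [Fintype E']
    (Γ' : QuantumGraph E') : Prop :=
  ∃ (Udom : Γ'.domain ≃ₗ[ℂ] homG Γ ρ Γ.domain) (U : GraphL2 Γ'.len ≃ₗ[ℂ] homG Γ ρ ⊤),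
    ∀ (f : Γ'.domain) (v : Fin r → ℂ),
      (U (Γ'.op f) : (Fin r → ℂ) →ₗ[ℂ] GraphL2 Γ.len) v =
        Γ.op ⟨(Udom f : (Fin r → ℂ) →ₗ[ℂ] GraphL2 Γ.len) v, (Udom f).2.2 v⟩

end QGraph

end

/-! A linear map `φ : ℂ^r → L²(Γ)` is the same as a family `F (k, e)` of edge functions, and the
relation `π(g) φ = φ ρ(g)`, read entry by entry, is the linear system that defines the kernel space,
with unknowns in `L²` of an edge instead of in `ℂ`. The theorem therefore reduces to facts about the
numerical matrix `Θ`.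

The columns of `Θ` form an orthonormal basis of the kernel space. They are orthonormal because
different blocks live on disjoint orbits, and they span because cutting a kernel vector down to one
orbit leaves a kernel vector. So `Θ* Θ = 1`, and `Θ Θ*` fixes every scalar solution
(`conjTranspose_theta_mul_theta`, `theta_mul_conjTranspose_mulVec`). Linear functionals on the edge
space carry the second identity over to invariant families of functions
(`thetaAction_thetaStarAction`). Hence `Θ` is a bijection from `L²(Γ_ρ)` onto invariant families
with inverse `Θ*`, and it preserves inner products.

For the domains, the boundary data of `Θ f` are `Θ̂` applied to those of `f`. They are invariant,
and `A`, `B` commute with `π̂(g)`, so the residual of the vertex conditions of `Γ` is again a kernel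
vector at each kind of end. The quotient conditions say that `Θ*` annihilates this residual, which
by `Θ Θ* w = w` forces it to vanish (`compress_mulVec_add_eq_zero_iff`). The diagram commutes
because `Θ` has constant entries and relates only edges with the same length and almost everywhere
the same potential (`unvecTheta_op`). -/

noncomputable section

namespace QGraph

/-! ### Identification of functions on edges of equal length -/

section Transport

theorem edgeTransport_self (l : ℝ) : edgeTransport l l = LinearMap.id := by
  simp [edgeTransport]

/-- Only the first two lengths have to agree: if `l''` is different, both sides are zero by the
default value of the transport. -/
theorem edgeTransport_edgeTransport {l l' : ℝ} (h : l = l') (l'' : ℝ) (x : EdgeL2 l) :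
    edgeTransport l' l'' (edgeTransport l l' x) = edgeTransport l l'' x := by
  subst h
  rw [edgeTransport_self, LinearMap.id_apply]

theorem inner_edgeTransport {l l' : ℝ} (h : l = l') (x y : EdgeL2 l) :
    ⟪edgeTransport l l' x, edgeTransport l l' y⟫_ℂ = ⟪x, y⟫_ℂ := by
  subst h
  rw [edgeTransport_self, LinearMap.id_apply, LinearMap.id_apply]

/-- Equality of lengths is not needed, since the transport is otherwise zero. This keeps length
conditions out of the `H²` statements for matrix actions. -/
theorem edgeTransport_mem_H2 {l : ℝ} (l' : ℝ) {x : EdgeL2 l} (hx : x ∈ H2 l) :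
    edgeTransport l l' x ∈ H2 l' := by
  by_cases h : l = l'
  · subst h
    rwa [edgeTransport_self]
  · rw [edgeTransport, dif_neg h]
    exact zero_mem _

theorem contRep_edgeTransport {l l' : ℝ} (h : l = l') (x : EdgeL2 l) :
    contRep (edgeTransport l l' x) = contRep x := by
  subst h
  rw [edgeTransport_self, LinearMap.id_apply]

theorem contRep_weakDeriv_edgeTransport {l l' : ℝ} (h : l = l') (x : EdgeL2 l) :
    contRep (weakDeriv (edgeTransport l l' x)) = contRep (weakDeriv x) := by
  subst h
  rw [edgeTransport_self, LinearMap.id_apply]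

theorem edgeOp_edgeTransport {l l' : ℝ} (h : l = l') (hl : 0 < l) (hl' : 0 < l') {V V' : ℝ → ℂ}
    (hV : MemLp V 2 (volume.restrict (Icc (0 : ℝ) l)))
    (hV' : MemLp V' 2 (volume.restrict (Icc (0 : ℝ) l')))
    (hVV' : V' =ᵐ[volume.restrict (Icc (0 : ℝ) l)] V) (x : H2 l) :
    edgeOp hl' hV' ⟨edgeTransport l l' x, edgeTransport_mem_H2 l' x.2⟩ =
      edgeTransport l l' (edgeOp hl hV x) := by
  subst h
  have e : (⟨edgeTransport l l x, edgeTransport_mem_H2 l x.2⟩ : H2 l) = x := by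
    ext1
    change edgeTransport l l x = (x : EdgeL2 l)
    rw [edgeTransport_self, LinearMap.id_apply]
  rw [e, edgeTransport_self, LinearMap.id_apply]
  -- The second-derivative terms agree; the potential enters only through the almost everywhere
  -- class of the product.
  change _ + MemLp.toLp _ _ = _ + MemLp.toLp _ _
  congr 1
  refine MemLp.toLp_congr _ _ ?_
  filter_upwards [hVV'] with t ht
  rw [ht]

end Transport

/-! ### Finite linear combinations of `H²` functions -/

section LinearCombination

variable {l : ℝ} {ι : Type*} (s : Finset ι) (c : ι → ℂ) {x : ι → EdgeL2 l}

theorem H2.sum_smul_mem (hx : ∀ j, x j ∈ H2 l) : ∑ j ∈ s, c j • x j ∈ H2 l :=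
  sum_mem fun j _ => (H2 l).smul_mem _ (hx j)

theorem H2.contRep_sum_smul (hl : 0 < l) (hx : ∀ j, x j ∈ H2 l) {t : ℝ} (ht : t ∈ Icc 0 l) :
    contRep (∑ j ∈ s, c j • x j) t = ∑ j ∈ s, c j * contRep (x j) t ∧
      contRep (weakDeriv (∑ j ∈ s, c j • x j)) t =
        ∑ j ∈ s, c j * contRep (weakDeriv (x j)) t := by
  classical
  induction s using Finset.induction_on with
  | empty => simpa using H2.contRep_zero hl ht
  | insert a s ha ih =>
    have h1 := H2.contRep_add hl ((H2 l).smul_mem (c a) (hx a)) (H2.sum_smul_mem s c hx) ht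
    have h2 := H2.contRep_smul hl (c a) (hx a) ht
    simp only [Finset.sum_insert ha, h1.1, h1.2, h2.1, h2.2, ih.1, ih.2, and_self]

theorem edgeOp_sum_smul (hl : 0 < l) {V : ℝ → ℂ}
    (hV : MemLp V 2 (volume.restrict (Icc (0 : ℝ) l))) (hx : ∀ j, x j ∈ H2 l) :
    edgeOp hl hV ⟨∑ j ∈ s, c j • x j, H2.sum_smul_mem s c hx⟩ =
      ∑ j ∈ s, c j • edgeOp hl hV ⟨x j, hx j⟩ := by
  have e : (⟨∑ j ∈ s, c j • x j, H2.sum_smul_mem s c hx⟩ : H2 l) =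
      ∑ j ∈ s, c j • (⟨x j, hx j⟩ : H2 l) := by
    ext1
    simp only [Submodule.coe_sum, Submodule.coe_smul]
  rw [e, map_sum]
  simp only [map_smul]

end LinearCombination

/-! ### Numerical matrices acting on families of edge functions -/

section MatrixAction

variable {m n o : Type*} [Fintype n] {len : n → ℝ} {len' : m → ℝ}

theorem matrixAction_apply (T : Matrix m n ℂ) (f : GraphL2 len) (k : m) :
    matrixAction len len' T f k = ∑ j, T k j • edgeTransport (len j) (len' k) (f j) := rfl

theorem matrixAction_mem_H2 (T : Matrix m n ℂ) {f : GraphL2 len} (hf : ∀ j, f j ∈ H2 (len j))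
    (k : m) : matrixAction len len' T f k ∈ H2 (len' k) :=
  H2.sum_smul_mem _ _ fun j => edgeTransport_mem_H2 _ (hf j)

theorem matrixAction_one [DecidableEq n] (f : GraphL2 len) : matrixAction len len 1 f = f := by
  ext1 k
  rw [matrixAction_apply, Finset.sum_eq_single k]
  · rw [Matrix.one_apply_eq, one_smul, edgeTransport_self, LinearMap.id_apply]
  · intro j _ hj
    rw [Matrix.one_apply_ne hj.symm, zero_smul]
  · simp

/-- Where `T` has a nonzero entry the two transports compose; where it vanishes nothing is to be
shown. The outer matrix needs no condition. -/
theorem matrixAction_matrixAction [Fintype m] {len'' : o → ℝ} (S : Matrix o m ℂ)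
    (T : Matrix m n ℂ) (hT : ∀ k j, T k j ≠ 0 → len j = len' k) (f : GraphL2 len) :
    matrixAction len' len'' S (matrixAction len len' T f) = matrixAction len len'' (S * T) f := by
  ext1 a
  simp only [matrixAction_apply, map_sum, map_smul, Matrix.mul_apply, Finset.sum_smul,
    Finset.smul_sum, ← mul_smul]
  rw [Finset.sum_comm]
  refine Finset.sum_congr rfl fun j _ => Finset.sum_congr rfl fun k _ => ?_
  by_cases h : T k j = 0
  · simp [h]
  · rw [edgeTransport_edgeTransport (hT k j h)]

theorem contRep_matrixAction (T : Matrix m n ℂ) (hT : ∀ k j, T k j ≠ 0 → len j = len' k)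
    {f : GraphL2 len} (hf : ∀ j, f j ∈ H2 (len j)) {k : m} (hl : 0 < len' k) {t : ℝ}
    (ht : t ∈ Icc 0 (len' k)) :
    contRep (matrixAction len len' T f k) t = ∑ j, T k j * contRep (f j) t ∧
      contRep (weakDeriv (matrixAction len len' T f k)) t =
        ∑ j, T k j * contRep (weakDeriv (f j)) t := by
  have h := H2.contRep_sum_smul Finset.univ (T k) hl
    (fun j => edgeTransport_mem_H2 (len' k) (hf j)) ht
  rw [matrixAction_apply, h.1, h.2]
  constructor <;> refine Finset.sum_congr rfl fun j _ => ?_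
  · by_cases h : T k j = 0
    · simp [h]
    · rw [contRep_edgeTransport (hT k j h)]
  · by_cases h : T k j = 0
    · simp [h]
    · rw [contRep_weakDeriv_edgeTransport (hT k j h)]

/-- Expanding both factors leaves inner products of transported functions that do not depend on `k`
as long as the coefficients are nonzero. The sum over `k` then produces the entries of `T* T`. -/
theorem inner_matrixAction [Fintype m] [DecidableEq n] (T : Matrix m n ℂ)
    (hT : ∀ k j, T k j ≠ 0 → len j = len' k) (hTT : T.conjTranspose * T = 1)
    (f f' : GraphL2 len) :
    ∑ k, ⟪matrixAction len len' T f k, matrixAction len len' T f' k⟫_ℂ = ⟪f, f'⟫_ℂ := by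
  -- Edges `i` and `j` both have the length of `k`, so the comparison can be moved from `k` to `i`,
  -- which removes `k`.
  have key : ∀ i j k, T k i ≠ 0 → T k j ≠ 0 →
      ⟪edgeTransport (len i) (len' k) (f i), edgeTransport (len j) (len' k) (f' j)⟫_ℂ =
        ⟪f i, edgeTransport (len j) (len i) (f' j)⟫_ℂ := by
    intro i j k hi hj
    have hij : len j = len i := (hT k j hj).trans (hT k i hi).symm
    rw [← edgeTransport_edgeTransport hij, inner_edgeTransport (hT k i hi)]
  have h1 : ∀ i j, ∑ k, star (T k i) * T k j *
      ⟪edgeTransport (len i) (len' k) (f i), edgeTransport (len j) (len' k) (f' j)⟫_ℂ =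
        (1 : Matrix n n ℂ) i j * ⟪f i, edgeTransport (len j) (len i) (f' j)⟫_ℂ := by
    intro i j
    rw [← hTT, Matrix.mul_apply, Finset.sum_mul]
    refine Finset.sum_congr rfl fun k _ => ?_
    rw [Matrix.conjTranspose_apply]
    by_cases hi : T k i = 0
    · simp [hi]
    by_cases hj : T k j = 0
    · simp [hj]
    rw [key i j k hi hj]
  calc _ = ∑ k, ∑ i, ∑ j, star (T k i) * T k j *
      ⟪edgeTransport (len i) (len' k) (f i), edgeTransport (len j) (len' k) (f' j)⟫_ℂ := by
        refine Finset.sum_congr rfl fun k _ => ?_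
        simp only [matrixAction_apply, sum_inner, inner_sum, inner_smul_left, inner_smul_right,
          starRingEnd_apply]
        simp only [Finset.mul_sum]
        rw [Finset.sum_comm]
        exact Finset.sum_congr rfl fun i _ => Finset.sum_congr rfl fun j _ => by ring
    _ = ∑ i, ∑ j, ∑ k, star (T k i) * T k j *
      ⟪edgeTransport (len i) (len' k) (f i), edgeTransport (len j) (len' k) (f' j)⟫_ℂ := by
        rw [Finset.sum_comm]
        exact Finset.sum_congr rfl fun i _ => Finset.sum_comm
    _ = ⟪f, f'⟫_ℂ := by
        simp only [h1, PiLp.inner_apply]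
        refine Finset.sum_congr rfl fun i _ => ?_
        rw [Finset.sum_eq_single i]
        · rw [Matrix.one_apply_eq, one_mul, edgeTransport_self, LinearMap.id_apply]
        · intro j _ hj
          rw [Matrix.one_apply_ne hj.symm, zero_mul]
        · simp

end MatrixAction

/-! ### The kernel space and the matrix `Θ` -/

section Theta

variable {G : Type*} [Group G] {E : Type*} [Fintype E] [DecidableEq E] [MulAction G E] {r : ℕ}
  {ρ : G →* GL (Fin r) ℂ} {D : Finset E}

/-- Coordinate form of the kernel equations, shaped to match the entrywise form of `π(g) φ = φ
ρ(g)`; the transpose of `ρ(g)` shows up in the index order `j k`. -/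
theorem mem_kernelSpace_iff {x : EuclideanSpace ℂ (Fin r × E)} :
    x ∈ kernelSpace ρ E ↔ ∀ (g : G) (k : Fin r) (e : E), x (k, g⁻¹ • e) =
      ∑ j, ((ρ g : GL (Fin r) ℂ) : Matrix (Fin r) (Fin r) ℂ) j k * x (j, e) := by
  have hg : ∀ (g : G) (k : Fin r) (e : E), (Matrix.toEuclideanLin
      ((1 : Matrix (Fin r) (Fin r) ℂ) ⊗ₖ permMatrix E g -
        ((ρ g : GL (Fin r) ℂ) : Matrix (Fin r) (Fin r) ℂ).transpose ⊗ₖ (1 : Matrix E E ℂ)) x)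
        (k, e) = x (k, g⁻¹ • e) -
          ∑ j, ((ρ g : GL (Fin r) ℂ) : Matrix (Fin r) (Fin r) ℂ) j k * x (j, e) := by
    intro g k e
    simp only [Matrix.toLpLin_apply, Matrix.sub_mulVec, Matrix.mulVec, dotProduct, Pi.sub_apply,
      Fintype.sum_prod_type, Matrix.kroneckerMap_apply, permMatrix, Matrix.of_apply,
      Matrix.one_apply, Matrix.transpose_apply]
    congr 1
    · rw [Finset.sum_eq_single k, Finset.sum_eq_single (g⁻¹ • e)]
      · simp
      · intro e' _ he'
        rw [if_neg (c := e = g • e')]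
        · simp
        · rintro rfl
          simp at he'
      · simp
      · intro j _ hj
        simp [hj.symm]
      · simp
    · simp
  simp only [kernelSpace, Submodule.mem_iInf, LinearMap.mem_ker]
  refine forall_congr' fun g => ⟨fun h k e => ?_, fun h => ?_⟩
  · have := hg g k e
    rw [h] at this
    exact (sub_eq_zero.mp this.symm)
  · ext ⟨k, e⟩
    rw [hg, h, sub_self]
    rfl

theorem theta_apply (b : OrbitBasis ρ D) (p : Fin r × E) (q : QuotientEdge ρ D) :
    theta b p q = (b q.1 q.2 : EuclideanSpace ℂ (Fin r × E)) p := rfl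

theorem mem_orbit_of_theta_ne_zero (b : OrbitBasis ρ D) {p : Fin r × E} {q : QuotientEdge ρ D}
    (h : theta b p q ≠ 0) : p.2 ∈ MulAction.orbit G (q.1 : E) := by
  by_contra hp
  exact h ((b q.1 q.2).2.2 p hp)

theorem theta_mem_kernelSpace (b : OrbitBasis ρ D) (q : QuotientEdge ρ D) (g : G) (k : Fin r)
    (e : E) : theta b (k, g⁻¹ • e) q =
      ∑ j, ((ρ g : GL (Fin r) ℂ) : Matrix (Fin r) (Fin r) ℂ) j k * theta b (j, e) q :=
  mem_kernelSpace_iff.mp (b q.1 q.2).2.1 g k e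

theorem IsFundamentalDomain.eq_of_theta_ne_zero (hD : IsFundamentalDomain G D)
    (b : OrbitBasis ρ D) {p : Fin r × E} {q q' : QuotientEdge ρ D} (h : theta b p q ≠ 0)
    (h' : theta b p q' ≠ 0) : q.1 = q'.1 :=
  Subtype.ext ((hD p.2).unique ⟨q.1.2, mem_orbit_of_theta_ne_zero b h⟩
    ⟨q'.1.2, mem_orbit_of_theta_ne_zero b h'⟩)

/-- Within a block this is orthonormality of the chosen basis; columns of different blocks are
supported on disjoint orbits. -/
theorem IsFundamentalDomain.conjTranspose_theta_mul_theta (hD : IsFundamentalDomain G D)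
    (b : OrbitBasis ρ D) : (theta b).conjTranspose * theta b = 1 := by
  ext q q'
  simp only [Matrix.mul_apply, Matrix.conjTranspose_apply]
  by_cases h : q.1 = q'.1
  · obtain ⟨i, j⟩ := q
    obtain ⟨i', j'⟩ := q'
    obtain rfl : i = i' := h
    have hb := orthonormal_iff_ite.mp (b i).orthonormal j j'
    rw [Submodule.coe_inner, PiLp.inner_apply] at hb
    simp only [RCLike.inner_apply, starRingEnd_apply] at hb
    simp only [theta_apply, Matrix.one_apply, Sigma.mk.injEq, heq_eq_eq, true_and]
    rw [← hb]
    exact Finset.sum_congr rfl fun p _ => mul_comm _ _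
  · rw [Matrix.one_apply_ne fun e => h (congrArg Sigma.fst e)]
    refine Finset.sum_eq_zero fun p _ => ?_
    by_contra hp
    rw [mul_eq_zero, not_or, star_eq_zero] at hp
    exact h (hD.eq_of_theta_ne_zero b hp.1 hp.2)

/-- `Θ Θ*` fixes the kernel space, which is the sum of its parts supported on the orbits. -/
theorem IsFundamentalDomain.theta_mul_conjTranspose_mulVec (hD : IsFundamentalDomain G D)
    (b : OrbitBasis ρ D) {x : Fin r × E → ℂ}
    (hx : ∀ (g : G) (k : Fin r) (e : E), x (k, g⁻¹ • e) =
      ∑ j, ((ρ g : GL (Fin r) ℂ) : Matrix (Fin r) (Fin r) ℂ) j k * x (j, e)) :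
    (theta b).mulVec ((theta b).conjTranspose.mulVec x) = x := by
  classical
  ext p
  obtain ⟨i, ⟨hiD, hip⟩, -⟩ := hD p.2
  -- The truncation of `x` to the orbit through `p`. An orbit and its complement are both stable
  -- under the group, so `y` still solves the kernel equations and expands in the basis of this
  -- block.
  set y : EuclideanSpace ℂ (Fin r × E) :=
    WithLp.toLp 2 fun p => if p.2 ∈ MulAction.orbit G i then x p else 0 with hy
  have hyp : ∀ p, y p = if p.2 ∈ MulAction.orbit G i then x p else 0 := fun _ => rfl
  have hyK : y ∈ orbitKernelSpace ρ i := by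
    refine ⟨mem_kernelSpace_iff.mpr fun g k e => ?_, fun p hp => if_neg hp⟩
    simp only [hyp]
    by_cases he : e ∈ MulAction.orbit G i
    · have he' : g⁻¹ • e ∈ MulAction.orbit G i := MulAction.mem_orbit_of_mem_orbit _ he
      simp only [he, he', if_true, hx]
    · have he' : g⁻¹ • e ∉ MulAction.orbit G i := fun h => he (by
        simpa using MulAction.mem_orbit_of_mem_orbit g h)
      simp only [he, he', if_false, mul_zero, Finset.sum_const_zero]
  -- The basis vectors vanish off the orbit, so pairing them with `y` or with `x` gives the same
  -- number.
  have hcoef : ∀ j, ⟪b ⟨i, hiD⟩ j, (⟨y, hyK⟩ : orbitKernelSpace ρ i)⟫_ℂ =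
      (theta b).conjTranspose.mulVec x ⟨⟨i, hiD⟩, j⟩ := by
    intro j
    rw [Submodule.coe_inner, PiLp.inner_apply]
    simp only [Matrix.mulVec, dotProduct, Matrix.conjTranspose_apply, RCLike.inner_apply,
      starRingEnd_apply, theta_apply]
    refine Finset.sum_congr rfl fun p _ => ?_
    rw [hyp, mul_comm]
    split_ifs with hp
    · rfl
    · rw [(b ⟨i, hiD⟩ j).2.2 p hp]
      simp
  have hsum := congrArg (fun z : orbitKernelSpace ρ i => (z : EuclideanSpace ℂ (Fin r × E)) p)
    ((b ⟨i, hiD⟩).sum_repr' ⟨y, hyK⟩)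
  simp only [hcoef, Submodule.coe_sum, Submodule.coe_smul] at hsum
  rw [hyp, if_pos hip] at hsum
  rw [← hsum, Matrix.mulVec, dotProduct, Fintype.sum_sigma, Finset.sum_eq_single ⟨i, hiD⟩]
  · rw [WithLp.ofLp_sum, Finset.sum_apply]
    exact Finset.sum_congr rfl fun j _ => mul_comm _ _
  -- A column of another block vanishes at `p`, because `p.2` lies in the orbit of only one element
  -- of `D`.
  · intro i' _ hi'
    refine Finset.sum_eq_zero fun j _ => ?_
    by_cases h : theta b p ⟨i', j⟩ = 0
    · rw [h, zero_mul]
    · exact absurd (Subtype.ext ((hD p.2).unique ⟨i'.2, mem_orbit_of_theta_ne_zero b h⟩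
        ⟨hiD, hip⟩)) hi'
  · simp

end Theta

end QGraph

namespace QGraph

/-! ### Linear maps `ℂ^r → L²(Γ)` as families of functions -/

section Unvec

variable {G : Type*} [Group G] {E : Type*} [MulAction G E] {r : ℕ} {len : E → ℝ}

/-- The entrywise form of the relation `π(g) φ = φ ρ(g)` for a family of functions. -/
def IsInvariantFamily (ρ : G →* GL (Fin r) ℂ) (F : GraphL2 (fun p : Fin r × E => len p.2)) :
    Prop :=
  ∀ (g : G) (k : Fin r) (e : E), edgeTransport (len (g⁻¹ • e)) (len e) (F (k, g⁻¹ • e)) =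
    ∑ j, ((ρ g : GL (Fin r) ℂ) : Matrix (Fin r) (Fin r) ℂ) j k • F (j, e)

theorem unvec_apply (F : GraphL2 (fun p : Fin r × E => len p.2)) (v : Fin r → ℂ) :
    unvec len r F v = ∑ k, v k • column len k F := rfl

theorem unvec_apply_apply (F : GraphL2 (fun p : Fin r × E => len p.2)) (v : Fin r → ℂ) (e : E) :
    unvec len r F v e = ∑ k, v k • F (k, e) := by
  rw [unvec_apply, WithLp.ofLp_sum, Finset.sum_apply]
  rfl

theorem unvec_single (F : GraphL2 (fun p : Fin r × E => len p.2)) (k : Fin r) :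
    unvec len r F (Pi.single k 1) = column len k F := by
  rw [unvec_apply, Finset.sum_eq_single k]
  · rw [Pi.single_eq_same, one_smul]
  · intro j _ hj
    rw [Pi.single_eq_of_ne hj, zero_smul]
  · simp

theorem unvec_mem_iff (W : Submodule ℂ (GraphL2 len))
    (F : GraphL2 (fun p : Fin r × E => len p.2)) :
    (∀ v, unvec len r F v ∈ W) ↔ ∀ k, column len k F ∈ W := by
  refine ⟨fun h k => unvec_single F k ▸ h _, fun h v => ?_⟩
  rw [unvec_apply]
  exact sum_mem fun k _ => W.smul_mem _ (h k)

theorem unvec_injective : Function.Injective (unvec len r) := by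
  intro F F' h
  ext1 p
  have := congrArg (fun φ => φ (Pi.single p.1 1) p.2) h
  simp only [unvec_single] at this
  exact this

theorem unvec_surjective : Function.Surjective (unvec len r) := by
  intro φ
  refine ⟨WithLp.toLp 2 fun p => φ (Pi.single p.1 1) p.2, ?_⟩
  refine LinearMap.pi_ext' fun k => LinearMap.ext_ring ?_
  rw [LinearMap.comp_apply, LinearMap.comp_apply, LinearMap.single_apply, unvec_single]
  rfl

/-- By linearity in `v` it is enough to test on the standard basis, where `ρ(g)` contributes its
`k`-th column. -/
theorem unvec_intertwines_iff (ρ : G →* GL (Fin r) ℂ)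
    (F : GraphL2 (fun p : Fin r × E => len p.2)) :
    (∀ (g : G) (v : Fin r → ℂ), edgeAction len g (unvec len r F v) =
      unvec len r F (((ρ g : GL (Fin r) ℂ) : Matrix (Fin r) (Fin r) ℂ).mulVec v)) ↔
      IsInvariantFamily ρ F := by
  constructor
  · intro h g k e
    have := congrArg (fun f : GraphL2 len => f e) (h g (Pi.single k 1))
    simp only [unvec_single, unvec_apply_apply, Matrix.mulVec_single_one] at this
    exact this
  · intro h g v
    ext1 e
    change edgeTransport _ _ (unvec len r F v (g⁻¹ • e)) = _
    simp only [unvec_apply_apply, map_sum, map_smul, h g _ e, Matrix.mulVec, dotProduct,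
      Finset.sum_smul, Finset.smul_sum]
    rw [Finset.sum_comm]
    refine Finset.sum_congr rfl fun j _ => Finset.sum_congr rfl fun k _ => ?_
    rw [smul_smul, mul_comm]

theorem homInner_unvec [Fintype E] (F F' : GraphL2 (fun p : Fin r × E => len p.2)) :
    homInner (unvec len r F) (unvec len r F') = ∑ p, ⟪F p, F' p⟫_ℂ := by
  simp only [homInner, unvec_single, PiLp.inner_apply, Fintype.sum_prod_type]
  rfl

end Unvec

/-! ### The bijection between `L²(Γ_ρ)` and invariant families -/

section Quotient

variable {G : Type*} [Group G] {E : Type*} [Fintype E] [DecidableEq E] [MulAction G E] {r : ℕ}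
  {ρ : G →* GL (Fin r) ℂ} {D : Finset E} {Γ : QuantumGraph E}

theorem IsPiSymmetric.len_eq_of_mem_orbit (hΓ : IsPiSymmetric G Γ) {i e : E}
    (h : e ∈ MulAction.orbit G i) : Γ.len i = Γ.len e := by
  obtain ⟨g, rfl⟩ := h
  exact (hΓ.len_smul g i).symm

theorem IsPiSymmetric.pot_eq_of_mem_orbit (hΓ : IsPiSymmetric G Γ) {i e : E}
    (h : e ∈ MulAction.orbit G i) :
    Γ.pot e =ᵐ[volume.restrict (Icc (0 : ℝ) (Γ.len i))] Γ.pot i := by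
  obtain ⟨g, rfl⟩ := h
  exact hΓ.pot_smul g i

variable (b : OrbitBasis ρ D)

theorem IsPiSymmetric.len_eq_of_theta_ne_zero (hΓ : IsPiSymmetric G Γ) (p : Fin r × E)
    (q : QuotientEdge ρ D) (h : theta b p q ≠ 0) : (quotientGraph Γ b).len q = Γ.len p.2 :=
  hΓ.len_eq_of_mem_orbit (mem_orbit_of_theta_ne_zero b h)

theorem IsPiSymmetric.len_eq_of_conjTranspose_theta_ne_zero (hΓ : IsPiSymmetric G Γ)
    (q : QuotientEdge ρ D) (p : Fin r × E) (h : (theta b).conjTranspose q p ≠ 0) :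
    Γ.len p.2 = (quotientGraph Γ b).len q := by
  rw [Matrix.conjTranspose_apply, star_ne_zero] at h
  exact (hΓ.len_eq_of_theta_ne_zero b p q h).symm

variable (Γ) in
/-- The action of `Θ` on functions on the quotient graph. -/
abbrev thetaAction : GraphL2 (quotientGraph Γ b).len →ₗ[ℂ]
    GraphL2 (fun p : Fin r × E => Γ.len p.2) :=
  matrixAction (quotientGraph Γ b).len (fun p : Fin r × E => Γ.len p.2) (theta b)

variable (Γ) in
/-- The action of `Θ*`, with values in the functions on the quotient graph. -/
abbrev thetaStarAction : GraphL2 (fun p : Fin r × E => Γ.len p.2) →ₗ[ℂ]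
    GraphL2 (quotientGraph Γ b).len :=
  matrixAction (fun p : Fin r × E => Γ.len p.2) (quotientGraph Γ b).len (theta b).conjTranspose

variable {b}

theorem thetaStarAction_thetaAction (hΓ : IsPiSymmetric G Γ) (hD : IsFundamentalDomain G D)
    (f : GraphL2 (quotientGraph Γ b).len) : thetaStarAction Γ b (thetaAction Γ b f) = f := by
  rw [thetaStarAction, matrixAction_matrixAction _ _ (hΓ.len_eq_of_theta_ne_zero b),
    hD.conjTranspose_theta_mul_theta, matrixAction_one]

/-- Each column of `Θ` satisfies the kernel equations, and these survive multiplying the column by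
the function `f q` and summing over `q`. -/
theorem isInvariantFamily_thetaAction (hΓ : IsPiSymmetric G Γ)
    (f : GraphL2 (quotientGraph Γ b).len) : IsInvariantFamily ρ (thetaAction Γ b f) := by
  intro g k e
  simp only [matrixAction_apply, map_sum, map_smul, Finset.smul_sum, smul_smul]
  rw [Finset.sum_comm]
  refine Finset.sum_congr rfl fun q _ => ?_
  refine Eq.trans ?_ (Finset.sum_smul (s := Finset.univ)
    (f := fun j => ((ρ g : GL (Fin r) ℂ) : Matrix (Fin r) (Fin r) ℂ) j k * theta b (j, e) q)
    (x := edgeTransport ((quotientGraph Γ b).len q) (Γ.len e) (f q)))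
  rw [← theta_mem_kernelSpace]
  by_cases h : theta b (k, g⁻¹ • e) q = 0
  · simp only [h, zero_smul]
  · rw [edgeTransport_edgeTransport (hΓ.len_eq_of_theta_ne_zero b _ _ h)]

/-- Passage from scalars to functions: a linear functional turns an invariant family into a scalar
solution of the kernel equations, which `Θ Θ*` fixes, and functionals separate points. Algebraic
functionals suffice, as all sums are finite. -/
theorem thetaAction_thetaStarAction (hΓ : IsPiSymmetric G Γ) (hD : IsFundamentalDomain G D)
    {F : GraphL2 (fun p : Fin r × E => Γ.len p.2)} (hF : IsInvariantFamily ρ F) :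
    thetaAction Γ b (thetaStarAction Γ b F) = F := by
  rw [thetaAction, matrixAction_matrixAction _ _ (hΓ.len_eq_of_conjTranspose_theta_ne_zero b)]
  ext1 p
  rw [← sub_eq_zero, ← Module.forall_dual_apply_eq_zero_iff ℂ]
  intro lam
  -- All entries are first transported to the edge of `p`, so that one functional applies to them.
  -- Entries from edges of another length become zero, consistently with the equations because `g`
  -- preserves lengths.
  have hx := hD.theta_mul_conjTranspose_mulVec b
    (x := fun p' => lam (edgeTransport (Γ.len p'.2) (Γ.len p.2) (F p'))) (fun g k e => by
      have hl : Γ.len (g⁻¹ • e) = Γ.len e := hΓ.len_smul _ _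
      simp only
      rw [← edgeTransport_edgeTransport hl, hF g k e]
      simp only [map_sum, map_smul, smul_eq_mul])
  have hp := congrFun hx p
  rw [edgeTransport_self, LinearMap.id_apply] at hp
  rw [map_sub, sub_eq_zero, ← hp, matrixAction_apply, Matrix.mulVec_mulVec]
  simp only [map_sum, map_smul, smul_eq_mul]
  rfl

theorem unvecTheta_mem_homG_top (hΓ : IsPiSymmetric G Γ) (f : GraphL2 (quotientGraph Γ b).len) :
    unvecTheta Γ b f ∈ homG Γ ρ ⊤ :=
  ⟨(unvec_intertwines_iff ρ _).mpr (isInvariantFamily_thetaAction hΓ f), fun _ => trivial⟩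

theorem unvecTheta_injective (hΓ : IsPiSymmetric G Γ) (hD : IsFundamentalDomain G D) :
    Function.Injective (unvecTheta Γ b) :=
  unvec_injective.comp (Function.LeftInverse.injective (thetaStarAction_thetaAction hΓ hD))

theorem exists_unvecTheta_eq (hΓ : IsPiSymmetric G Γ) (hD : IsFundamentalDomain G D)
    {W : Submodule ℂ (GraphL2 Γ.len)} {φ : (Fin r → ℂ) →ₗ[ℂ] GraphL2 Γ.len}
    (hφ : φ ∈ homG Γ ρ W) : ∃ f, unvecTheta Γ b f = φ := by
  obtain ⟨F, rfl⟩ := unvec_surjective φ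
  exact ⟨thetaStarAction Γ b F, congrArg (unvec Γ.len r) (thetaAction_thetaStarAction hΓ hD
    ((unvec_intertwines_iff ρ F).mp hφ.1))⟩

theorem homInner_unvecTheta (hΓ : IsPiSymmetric G Γ) (hD : IsFundamentalDomain G D)
    (f f' : GraphL2 (quotientGraph Γ b).len) :
    homInner (unvecTheta Γ b f) (unvecTheta Γ b f') = ⟪f, f'⟫_ℂ :=
  (homInner_unvec _ _).trans (inner_matrixAction _ (hΓ.len_eq_of_theta_ne_zero b)
    (hD.conjTranspose_theta_mul_theta b) f f')

/-- Taking traces commutes with `Θ`. The `H²` hypothesis is what makes boundary values of functions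
and derivatives additive. -/
theorem trace_column_thetaAction (hΓ : IsPiSymmetric G Γ)
    {f : GraphL2 (quotientGraph Γ b).len} (hf : ∀ q, f q ∈ H2 ((quotientGraph Γ b).len q))
    (k : Fin r) (e : E) (s : Fin 2) :
    Γ.traceD (column Γ.len k (thetaAction Γ b f)) (e, s) =
        ∑ q, theta b (k, e) q * (quotientGraph Γ b).traceD f (q, s) ∧
      Γ.traceN (column Γ.len k (thetaAction Γ b f)) (e, s) =
        ∑ q, theta b (k, e) q * (quotientGraph Γ b).traceN f (q, s) := by
  have hlen := hΓ.len_eq_of_theta_ne_zero b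
  have h0 := contRep_matrixAction (len' := fun p : Fin r × E => Γ.len p.2) (theta b) hlen hf
    (k := (k, e)) (Γ.len_pos e) (left_mem_Icc.mpr (Γ.len_pos e).le)
  have h1 := contRep_matrixAction (len' := fun p : Fin r × E => Γ.len p.2) (theta b) hlen hf
    (k := (k, e)) (Γ.len_pos e) (right_mem_Icc.mpr (Γ.len_pos e).le)
  have hc : column Γ.len k (thetaAction Γ b f) e = thetaAction Γ b f (k, e) := rfl
  -- The terminal end sits at the length of `q` on one side and of `e` on the other; these agree
  -- wherever `Θ` has a nonzero entry.
  have hend : ∀ u : QuotientEdge ρ D → ℝ → ℂ,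
      ∑ q, theta b (k, e) q * u q ((quotientGraph Γ b).len q) =
        ∑ q, theta b (k, e) q * u q (Γ.len e) := by
    refine fun u => Finset.sum_congr rfl fun q _ => ?_
    by_cases h : theta b (k, e) q = 0
    · simp only [h, zero_mul]
    · rw [hlen _ _ h]
  simp only [QuantumGraph.traceD, QuantumGraph.traceN, hc]
  split_ifs
  · exact h0
  · refine ⟨h1.1.trans (hend fun q => contRep (f q)).symm, ?_⟩
    simp only [mul_neg, Finset.sum_neg_distrib, neg_inj]
    exact h1.2.trans (hend fun q => contRep (weakDeriv (f q))).symm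

end Quotient

end QGraph

namespace QGraph

/-! ### Boundary data and the compressed matrices -/

section VertexConditions

variable {G : Type*} [Group G] {E : Type*} [Fintype E] [DecidableEq E] [MulAction G E] {r : ℕ}
  {ρ : G →* GL (Fin r) ℂ} {D : Finset E}

/-- Conjugation by a permutation matrix relabels rows and columns, so the hypothesis on `A` and `B`
becomes invariance of their entries under moving both edges by `g`. -/
theorem conjTranspose_permMatrixHat_mul_mul_apply (g : G)
    (M : Matrix (E × Fin 2) (E × Fin 2) ℂ) (p p' : E × Fin 2) :
    ((permMatrixHat E g).conjTranspose * M * permMatrixHat E g) p p' =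
      M (g • p.1, p.2) (g • p'.1, p'.2) := by
  have h : ∀ p p' : E × Fin 2,
      permMatrixHat E g p p' = if p = (g • p'.1, p'.2) then 1 else 0 := by
    rintro ⟨e, s⟩ ⟨e', s'⟩
    simp only [permMatrixHat, permMatrix, Matrix.kroneckerMap_apply, Matrix.of_apply,
      Matrix.one_apply, Prod.mk.injEq, ite_and, mul_ite, mul_one, mul_zero]
    split_ifs <;> rfl
  simp only [Matrix.mul_apply, Matrix.conjTranspose_apply, h, apply_ite star, star_one, star_zero,
    ite_mul, one_mul, zero_mul, mul_ite, mul_one, mul_zero, Finset.sum_ite_eq', Finset.mem_univ,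
    if_true]

/-- A matrix commuting with the edge permutations acts on the edge index, `ρ` on the index `k`, so
the two do not interfere and invariant data stay invariant. -/
theorem mulVec_invariant {M : Matrix (E × Fin 2) (E × Fin 2) ℂ}
    (hM : ∀ g : G, (permMatrixHat E g).conjTranspose * M * permMatrixHat E g = M)
    {Z : Fin r → E × Fin 2 → ℂ}
    (hZ : ∀ (s : Fin 2) (g : G) (k : Fin r) (e : E), Z k (g⁻¹ • e, s) =
      ∑ j, ((ρ g : GL (Fin r) ℂ) : Matrix (Fin r) (Fin r) ℂ) j k * Z j (e, s))
    (s : Fin 2) (g : G) (k : Fin r) (e : E) : M.mulVec (Z k) (g⁻¹ • e, s) =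
      ∑ j, ((ρ g : GL (Fin r) ℂ) : Matrix (Fin r) (Fin r) ℂ) j k * M.mulVec (Z j) (e, s) := by
  have hM' : ∀ p p', M (g⁻¹ • p.1, p.2) (g⁻¹ • p'.1, p'.2) = M p p' := fun p p' =>
    (conjTranspose_permMatrixHat_mul_mul_apply g⁻¹ M p p').symm.trans (by rw [hM])
  -- The summation index is shifted by `g⁻¹`, which puts the same group element on both indices of
  -- `M`, where it cancels.
  have h1 : M.mulVec (Z k) (g⁻¹ • e, s) = ∑ p : E × Fin 2, M (e, s) p * Z k (g⁻¹ • p.1, p.2) := by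
    rw [Matrix.mulVec, dotProduct, ← Equiv.sum_comp
      ((MulAction.toPerm (g⁻¹ : G) : Equiv.Perm E).prodCongr (Equiv.refl (Fin 2)))]
    refine Finset.sum_congr rfl fun p _ => ?_
    rw [← hM' (e, s) p]
    rfl
  rw [h1]
  simp only [hZ, Matrix.mulVec, dotProduct, Finset.mul_sum]
  rw [Finset.sum_comm]
  refine Finset.sum_congr rfl fun j _ => Finset.sum_congr rfl fun p _ => ?_
  rw [mul_left_comm]

theorem thetaHat_mulVec (b : OrbitBasis ρ D) (X : QuotientEdge ρ D × Fin 2 → ℂ) (k : Fin r)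
    (e : E) (s : Fin 2) :
    (thetaHat b).mulVec X (k, e, s) = ∑ q, theta b (k, e) q * X (q, s) := by
  simp only [thetaHat, Matrix.mulVec, dotProduct, Matrix.submatrix_apply,
    Equiv.prodAssoc_symm_apply, id_eq, Matrix.kroneckerMap_apply, Fintype.sum_prod_type,
    Matrix.one_apply, mul_ite, mul_one, mul_zero, ite_mul, zero_mul, Finset.sum_ite_eq,
    Finset.mem_univ, if_true]

theorem conjTranspose_thetaHat_mulVec (b : OrbitBasis ρ D) (Y : Fin r × (E × Fin 2) → ℂ)
    (q : QuotientEdge ρ D) (s : Fin 2) :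
    (thetaHat b).conjTranspose.mulVec Y (q, s) =
      (theta b).conjTranspose.mulVec (fun p => Y (p.1, p.2, s)) q := by
  simp only [thetaHat, Matrix.mulVec, dotProduct, Matrix.submatrix_apply,
    Equiv.prodAssoc_symm_apply, id_eq, Matrix.kroneckerMap_apply, Fintype.sum_prod_type,
    Matrix.one_apply, Matrix.conjTranspose_apply, mul_ite, mul_one, mul_zero, ite_mul, zero_mul,
    apply_ite star, star_zero, Finset.sum_ite_eq', Finset.mem_univ, if_true]

/-- The middle factor `I_r ⊗ M` applies `M` to each of the `r` columns separately. -/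
theorem compress_mulVec (b : OrbitBasis ρ D) (M : Matrix (E × Fin 2) (E × Fin 2) ℂ)
    (X : QuotientEdge ρ D × Fin 2 → ℂ) :
    (compress b M).mulVec X = (thetaHat b).conjTranspose.mulVec fun p =>
      M.mulVec (fun p' => (thetaHat b).mulVec X (p.1, p')) p.2 := by
  rw [compress, Matrix.mul_assoc, ← Matrix.mulVec_mulVec, ← Matrix.mulVec_mulVec]
  congr 1
  ext ⟨k, p⟩
  rw [Matrix.mulVec, dotProduct, Fintype.sum_prod_type, Finset.sum_eq_single k]
  · simp only [Matrix.kroneckerMap_apply, Matrix.one_apply_eq, one_mul]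
    rfl
  · intro j _ hj
    simp [Matrix.one_apply_ne hj.symm]
  · simp

end VertexConditions

/-! ### Operator domains and the commuting square -/

section Domain

variable {G : Type*} [Group G] {E : Type*} [Fintype E] [DecidableEq E] [MulAction G E] {r : ℕ}
  {ρ : G →* GL (Fin r) ℂ} {D : Finset E} {Γ : QuantumGraph E} {b : OrbitBasis ρ D}

/-- The vertex conditions of the quotient graph hold for a function with traces `X` and `X'` if
and only if every column of its image under `Θ` satisfies the vertex conditions of the graph. -/
theorem compress_mulVec_add_eq_zero_iff (hD : IsFundamentalDomain G D)
    {A B : Matrix (E × Fin 2) (E × Fin 2) ℂ}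
    (hA : ∀ g : G, (permMatrixHat E g).conjTranspose * A * permMatrixHat E g = A)
    (hB : ∀ g : G, (permMatrixHat E g).conjTranspose * B * permMatrixHat E g = B)
    (X X' : QuotientEdge ρ D × Fin 2 → ℂ) :
    (compress b A).mulVec X + (compress b B).mulVec X' = 0 ↔
      ∀ k, A.mulVec (fun p => (thetaHat b).mulVec X (k, p)) +
        B.mulVec (fun p => (thetaHat b).mulVec X' (k, p)) = 0 := by
  rw [compress_mulVec, compress_mulVec, ← Matrix.mulVec_add]
  have hinv : ∀ (X : QuotientEdge ρ D × Fin 2 → ℂ) (s : Fin 2) (g : G) (k : Fin r) (e : E),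
      (thetaHat b).mulVec X (k, g⁻¹ • e, s) =
        ∑ j, ((ρ g : GL (Fin r) ℂ) : Matrix (Fin r) (Fin r) ℂ) j k *
          (thetaHat b).mulVec X (j, e, s) := by
    intro X s g k e
    simp only [thetaHat_mulVec, theta_mem_kernelSpace, Finset.sum_mul, Finset.mul_sum]
    rw [Finset.sum_comm]
    simp only [mul_assoc]
  constructor
  · intro h k
    ext ⟨e, s⟩
    -- For a fixed kind of end `s` the residual of the vertex conditions is a kernel vector, hence
    -- fixed by `Θ Θ*`. The assumption says that `Θ*` kills it.
    have hfix := hD.theta_mul_conjTranspose_mulVec b (x := fun p =>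
        A.mulVec (fun p' => (thetaHat b).mulVec X (p.1, p')) (p.2, s) +
          B.mulVec (fun p' => (thetaHat b).mulVec X' (p.1, p')) (p.2, s)) (fun g k e => by
      have h1 := mulVec_invariant hA (Z := fun k p => (thetaHat b).mulVec X (k, p)) (hinv X)
        s g k e
      have h2 := mulVec_invariant hB (Z := fun k p => (thetaHat b).mulVec X' (k, p)) (hinv X')
        s g k e
      simp only at h1 h2 ⊢
      rw [h1, h2, ← Finset.sum_add_distrib]
      simp only [mul_add])
    have hz : (theta b).conjTranspose.mulVec (fun p =>
        A.mulVec (fun p' => (thetaHat b).mulVec X (p.1, p')) (p.2, s) +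
          B.mulVec (fun p' => (thetaHat b).mulVec X' (p.1, p')) (p.2, s)) = 0 := by
      ext q
      have := congrFun h (q, s)
      rw [conjTranspose_thetaHat_mulVec] at this
      exact this
    rw [hz, Matrix.mulVec_zero] at hfix
    exact (congrFun hfix (k, e)).symm
  · intro h
    refine (congrArg _ ?_).trans (Matrix.mulVec_zero _)
    funext ⟨k, p⟩
    exact congrFun (h k) p

/-- Both `Θ` and `Θ*` form finite linear combinations and so preserve `H²`; conversely `f` is
recovered as `Θ* Θ f`. -/
theorem forall_mem_H2_iff (hΓ : IsPiSymmetric G Γ) (hD : IsFundamentalDomain G D)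
    (f : GraphL2 (quotientGraph Γ b).len) :
    (∀ q, f q ∈ H2 ((quotientGraph Γ b).len q)) ↔
      ∀ p : Fin r × E, thetaAction Γ b f p ∈ H2 (Γ.len p.2) := by
  refine ⟨fun h p => matrixAction_mem_H2 (len := (quotientGraph Γ b).len)
    (len' := fun p : Fin r × E => Γ.len p.2) (theta b) h p, fun h q => ?_⟩
  rw [← thetaStarAction_thetaAction hΓ hD f]
  exact matrixAction_mem_H2 (len := fun p : Fin r × E => Γ.len p.2)
    (len' := (quotientGraph Γ b).len) (theta b).conjTranspose h q

theorem mem_domain_quotientGraph_iff (hΓ : IsPiSymmetric G Γ) (hD : IsFundamentalDomain G D)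
    (hA : ∀ g : G, (permMatrixHat E g).conjTranspose * Γ.A * permMatrixHat E g = Γ.A)
    (hB : ∀ g : G, (permMatrixHat E g).conjTranspose * Γ.B * permMatrixHat E g = Γ.B)
    (f : GraphL2 (quotientGraph Γ b).len) :
    f ∈ (quotientGraph Γ b).domain ↔ unvecTheta Γ b f ∈ homG Γ ρ Γ.domain := by
  have hcol : unvecTheta Γ b f ∈ homG Γ ρ Γ.domain ↔
      ∀ k, column Γ.len k (thetaAction Γ b f) ∈ Γ.domain :=
    (and_iff_right (unvecTheta_mem_homG_top hΓ f).1).trans (unvec_mem_iff _ _)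
  have htr : (∀ q, f q ∈ H2 ((quotientGraph Γ b).len q)) → ∀ k,
      Γ.traceD (column Γ.len k (thetaAction Γ b f)) =
        (fun p => (thetaHat b).mulVec ((quotientGraph Γ b).traceD f) (k, p)) ∧
      Γ.traceN (column Γ.len k (thetaAction Γ b f)) =
        (fun p => (thetaHat b).mulVec ((quotientGraph Γ b).traceN f) (k, p)) := by
    intro hf k
    constructor <;> ext ⟨e, s⟩ <;> rw [thetaHat_mulVec]
    exacts [(trace_column_thetaAction hΓ hf k e s).1, (trace_column_thetaAction hΓ hf k e s).2]
  rw [hcol]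
  constructor
  · rintro ⟨hf, hv⟩ k
    refine ⟨fun e => (forall_mem_H2_iff hΓ hD f).mp hf (k, e), ?_⟩
    rw [(htr hf k).1, (htr hf k).2]
    exact (compress_mulVec_add_eq_zero_iff hD hA hB _ _).mp hv k
  · intro h
    -- Regularity has to come before the vertex conditions: the trace formula is available only for
    -- `f` in `H²`.
    have hf := (forall_mem_H2_iff hΓ hD f).mpr fun p => (h p.1).1 p.2
    refine ⟨hf, (compress_mulVec_add_eq_zero_iff hD hA hB _ _).mpr fun k => ?_⟩
    rw [← (htr hf k).1, ← (htr hf k).2]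
    exact (h k).2

/-- On each edge the image is a combination of transported functions with constant coefficients. The
edge operator is linear and commutes with those transports that carry a nonzero entry of `Θ`. -/
theorem unvecTheta_op (hΓ : IsPiSymmetric G Γ) (f : (quotientGraph Γ b).domain) (v : Fin r → ℂ)
    (hv : unvecTheta Γ b f v ∈ Γ.domain) :
    unvecTheta Γ b ((quotientGraph Γ b).op f) v = Γ.op ⟨unvecTheta Γ b f v, hv⟩ := by
  ext1 e
  have hH : ∀ k, thetaAction Γ b f (k, e) ∈ H2 (Γ.len e) :=
    fun k => matrixAction_mem_H2 (len := (quotientGraph Γ b).len)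
      (len' := fun p : Fin r × E => Γ.len p.2) (theta b) f.2.1 (k, e)
  have hop : ∀ k, thetaAction Γ b ((quotientGraph Γ b).op f) (k, e) =
      edgeOp (Γ.len_pos e) (Γ.pot_memLp e) ⟨thetaAction Γ b f (k, e), hH k⟩ := by
    intro k
    refine Eq.trans ?_ (edgeOp_sum_smul Finset.univ (theta b (k, e)) (Γ.len_pos e)
      (Γ.pot_memLp e) fun q => edgeTransport_mem_H2 (Γ.len e) (f.2.1 q)).symm
    refine Finset.sum_congr rfl fun q _ => ?_
    by_cases h : theta b (k, e) q = 0
    · simp only [h, zero_smul]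
    · exact congrArg _ (edgeOp_edgeTransport (hΓ.len_eq_of_theta_ne_zero b _ _ h)
        ((quotientGraph Γ b).len_pos q) (Γ.len_pos e) ((quotientGraph Γ b).pot_memLp q)
        (Γ.pot_memLp e) (hΓ.pot_eq_of_mem_orbit (mem_orbit_of_theta_ne_zero b h))
        ⟨(f : GraphL2 (quotientGraph Γ b).len) q, f.2.1 q⟩).symm
  have hsum := edgeOp_sum_smul Finset.univ v (Γ.len_pos e) (Γ.pot_memLp e) hH
  have hval := unvec_apply_apply (thetaAction Γ b f) v e
  calc unvecTheta Γ b ((quotientGraph Γ b).op f) v e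
      = ∑ k, v k • thetaAction Γ b ((quotientGraph Γ b).op f) (k, e) := unvec_apply_apply _ v e
    _ = ∑ k, v k • edgeOp (Γ.len_pos e) (Γ.pot_memLp e) ⟨thetaAction Γ b f (k, e), hH k⟩ :=
        Finset.sum_congr rfl fun k _ => congrArg _ (hop k)
    _ = edgeOp (Γ.len_pos e) (Γ.pot_memLp e) ⟨unvecTheta Γ b f v e, hv.1 e⟩ := by
        rw [← hsum]
        exact congrArg _ (Subtype.ext hval.symm)

end Domain

end QGraph

namespace QGraph

/-! ### Assembling the isomorphisms -/

section Isomorphisms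

variable {G : Type*} [Group G] {E : Type*} [Fintype E] [DecidableEq E] [MulAction G E] {r : ℕ}
  {ρ : G →* GL (Fin r) ℂ} {D : Finset E} {Γ : QuantumGraph E} {b : OrbitBasis ρ D}

variable (b) in
/-- The isomorphism `vec⁻¹ ∘ Θ` from `L²(Γ_ρ)` onto `Hom_G(V_ρ, L²(Γ))`. -/
def unvecThetaEquiv (hΓ : IsPiSymmetric G Γ) (hD : IsFundamentalDomain G D) :
    GraphL2 (quotientGraph Γ b).len ≃ₗ[ℂ] homG Γ ρ ⊤ :=
  LinearEquiv.ofBijective ((unvecTheta Γ b).codRestrict _ (unvecTheta_mem_homG_top hΓ))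
    ⟨fun _ _ h => unvecTheta_injective hΓ hD (congrArg Subtype.val h), fun φ =>
      (exists_unvecTheta_eq hΓ hD φ.2).imp fun _ hf => Subtype.ext hf⟩

theorem coe_unvecThetaEquiv (hΓ : IsPiSymmetric G Γ) (hD : IsFundamentalDomain G D)
    (f : GraphL2 (quotientGraph Γ b).len) :
    (unvecThetaEquiv b hΓ hD f : (Fin r → ℂ) →ₗ[ℂ] GraphL2 Γ.len) = unvecTheta Γ b f := rfl

variable (b) in
/-- The restriction of `vec⁻¹ ∘ Θ` to the domain of the Schrödinger operator of `Γ_ρ`. -/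
def unvecThetaDomain (hmem : ∀ f : GraphL2 (quotientGraph Γ b).len,
    f ∈ (quotientGraph Γ b).domain → unvecTheta Γ b f ∈ homG Γ ρ Γ.domain) :
    (quotientGraph Γ b).domain →ₗ[ℂ] homG Γ ρ Γ.domain :=
  (unvecTheta Γ b ∘ₗ (quotientGraph Γ b).domain.subtype).codRestrict _ fun f => hmem f f.2

/-- Everything is inherited from the `L²` level: the reverse direction of `hmem` places the `L²`
preimage in the domain. -/
theorem unvecThetaDomain_bijective (hΓ : IsPiSymmetric G Γ) (hD : IsFundamentalDomain G D)
    (hmem : ∀ f : GraphL2 (quotientGraph Γ b).len,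
      f ∈ (quotientGraph Γ b).domain ↔ unvecTheta Γ b f ∈ homG Γ ρ Γ.domain) :
    Function.Bijective (unvecThetaDomain b fun f => (hmem f).mp) := by
  constructor
  · intro f f' h
    exact Subtype.ext (unvecTheta_injective hΓ hD (congrArg Subtype.val h))
  · intro φ
    obtain ⟨f, hf⟩ := exists_unvecTheta_eq (b := b) hΓ hD φ.2
    have hφ : unvecTheta Γ b f ∈ homG Γ ρ Γ.domain := by
      rw [hf]
      exact φ.2
    exact ⟨⟨f, (hmem f).mpr hφ⟩, Subtype.ext hf⟩

variable (b) in
/-- The isomorphism `vec⁻¹ ∘ Θ` from `Dom(Op_ρ)` onto `Hom_G(V_ρ, Dom(Op))`. -/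
def unvecThetaDomainEquiv (hΓ : IsPiSymmetric G Γ) (hD : IsFundamentalDomain G D)
    (hA : ∀ g : G, (permMatrixHat E g).conjTranspose * Γ.A * permMatrixHat E g = Γ.A)
    (hB : ∀ g : G, (permMatrixHat E g).conjTranspose * Γ.B * permMatrixHat E g = Γ.B) :
    (quotientGraph Γ b).domain ≃ₗ[ℂ] homG Γ ρ Γ.domain :=
  LinearEquiv.ofBijective _
    (unvecThetaDomain_bijective hΓ hD (mem_domain_quotientGraph_iff (b := b) hΓ hD hA hB))

theorem coe_unvecThetaDomainEquiv (hΓ : IsPiSymmetric G Γ) (hD : IsFundamentalDomain G D)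
    (hA : ∀ g : G, (permMatrixHat E g).conjTranspose * Γ.A * permMatrixHat E g = Γ.A)
    (hB : ∀ g : G, (permMatrixHat E g).conjTranspose * Γ.B * permMatrixHat E g = Γ.B)
    (f : (quotientGraph Γ b).domain) :
    (unvecThetaDomainEquiv b hΓ hD hA hB f : (Fin r → ℂ) →ₗ[ℂ] GraphL2 Γ.len) =
      unvecTheta Γ b f := rfl

theorem unvecThetaEquiv_op (hΓ : IsPiSymmetric G Γ) (hD : IsFundamentalDomain G D)
    (hA : ∀ g : G, (permMatrixHat E g).conjTranspose * Γ.A * permMatrixHat E g = Γ.A)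
    (hB : ∀ g : G, (permMatrixHat E g).conjTranspose * Γ.B * permMatrixHat E g = Γ.B)
    (f : (quotientGraph Γ b).domain) (v : Fin r → ℂ) :
    (unvecThetaEquiv b hΓ hD ((quotientGraph Γ b).op f) :
      (Fin r → ℂ) →ₗ[ℂ] GraphL2 Γ.len) v =
        Γ.op ⟨(unvecThetaDomainEquiv b hΓ hD hA hB f : (Fin r → ℂ) →ₗ[ℂ] GraphL2 Γ.len) v,
          (unvecThetaDomainEquiv b hΓ hD hA hB f).2.2 v⟩ :=
  unvecTheta_op hΓ f v ((unvecThetaDomainEquiv b hΓ hD hA hB f).2.2 v)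

end Isomorphisms

end QGraph

end

theorem theorem6p4 {G : Type*} [Group G] {E : Type*} [Fintype E] [DecidableEq E] [MulAction G E]
    (Γ : QGraph.QuantumGraph E) (hsymm : QGraph.IsPiSymmetric G Γ)
    (hA : ∀ g : G, (QGraph.permMatrixHat E g).conjTranspose * Γ.A * QGraph.permMatrixHat E g = Γ.A)
    (hB : ∀ g : G, (QGraph.permMatrixHat E g).conjTranspose * Γ.B * QGraph.permMatrixHat E g = Γ.B)
    {r : ℕ} (ρ : G →* GL (Fin r) ℂ)
    (D : Finset E) (hD : QGraph.IsFundamentalDomain G D) (b : QGraph.OrbitBasis ρ D) :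
    (∃ (Udom : (QGraph.quotientGraph Γ b).domain ≃ₗ[ℂ] QGraph.homG Γ ρ Γ.domain)
      (U : QGraph.GraphL2 (QGraph.quotientGraph Γ b).len ≃ₗ[ℂ] QGraph.homG Γ ρ ⊤),
      (∀ f, (Udom f : (Fin r → ℂ) →ₗ[ℂ] QGraph.GraphL2 Γ.len) = QGraph.unvecTheta Γ b f) ∧
      (∀ f, (U f : (Fin r → ℂ) →ₗ[ℂ] QGraph.GraphL2 Γ.len) = QGraph.unvecTheta Γ b f) ∧
      (∀ f f' : (QGraph.quotientGraph Γ b).domain,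
        QGraph.homInner (Udom f : (Fin r → ℂ) →ₗ[ℂ] QGraph.GraphL2 Γ.len) (Udom f') =
          inner ℂ (f : QGraph.GraphL2 (QGraph.quotientGraph Γ b).len) f') ∧
      (∀ f f' : QGraph.GraphL2 (QGraph.quotientGraph Γ b).len,
        QGraph.homInner (U f : (Fin r → ℂ) →ₗ[ℂ] QGraph.GraphL2 Γ.len) (U f') = inner ℂ f f') ∧
      (∀ (f : (QGraph.quotientGraph Γ b).domain) (v : Fin r → ℂ),
        (U ((QGraph.quotientGraph Γ b).op f) : (Fin r → ℂ) →ₗ[ℂ] QGraph.GraphL2 Γ.len) v =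
          Γ.op ⟨(Udom f : (Fin r → ℂ) →ₗ[ℂ] QGraph.GraphL2 Γ.len) v, (Udom f).2.2 v⟩)) ∧
    QGraph.IsQuotientGraph Γ ρ (QGraph.quotientGraph Γ b) := by
  have hop := QGraph.unvecThetaEquiv_op (b := b) hsymm hD hA hB
  refine ⟨⟨QGraph.unvecThetaDomainEquiv b hsymm hD hA hB, QGraph.unvecThetaEquiv b hsymm hD,
    QGraph.coe_unvecThetaDomainEquiv hsymm hD hA hB, QGraph.coe_unvecThetaEquiv hsymm hD,
    fun f f' => ?_, fun f f' => ?_, hop⟩,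
    QGraph.unvecThetaDomainEquiv b hsymm hD hA hB, QGraph.unvecThetaEquiv b hsymm hD, hop⟩
  · rw [QGraph.coe_unvecThetaDomainEquiv, QGraph.coe_unvecThetaDomainEquiv]
    exact QGraph.homInner_unvecTheta hsymm hD _ _
  · rw [QGraph.coe_unvecThetaEquiv, QGraph.coe_unvecThetaEquiv]
    exact QGraph.homInner_unvecTheta hsymm hD _ _
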